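/- All curves are regular plane curves of class $C^2$; $\tau=\sigma_x/|\sigma_x|$ is the unit tangent, $\nu$ is its counterclockwise rotation by $\pi/2$, and $k=\langle\sigma_{xx},\nu\rangle/|\sigma_x|^2$ is the curvature. A complete embedded triod without end points consists of three injective curves $\sigma^i:[0,\infty)\to\mathbb R^2$, each of infinite length, that meet each other exactly at a common initial point (the 3-point), where their unit tangents satisfy $\tau^1+\tau^2+\tau^3=0$ (angles of $120$ degrees). A complete embedded curve without end points is an injective curve $\mathbb R\to\mathbb R^2$ of infinite length in both directions; a complete embedded curve with one end point is an injective curve $[0,\infty)\to\mathbb R^2$ of infinite length. (Closed, unbounded, properly embedded triods and curves are complete in this sense.) **Shrinkers.** Suppose $k=-\langle x,\nu\rangle$ at every point $x$. 1. If a complete embedded triod without end points satisfies this equation, then its 3-point is the origin and its three curves are half-lines from the origin forming angles of $120$ degrees; in particular $k\equiv0$. 2. If a complete embedded curve without end points satisfies it, then it is a straight line through the origin; in particular $k\equiv0$. 3. If a complete embedded curve with one end point satisfies it, then it is a half-line (contained in a line through the origin); in particular $k\equiv0$. **Flows.** Let $I\subset\mathbb R$ be an interval with more than one point and let $(\mathbb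 T_t)_{t\in I}$ be a family of complete embedded triods without end points, or of complete embedded curves with no or with one end point, that flows by curvature: locally in space and time it is parametrized by embedded arcs $\gamma(\cdot,t)$ (around a 3-point, by embedded triods) whose points have a velocity $\gamma_t$ with $\langle\gamma_t,\nu\rangle=k$. Suppose that it shrinks homothetically around a point $c$: there is a differentiable, strictly decreasing $r:I\to(0,\infty)$ with $\mathbb T_t=c+\frac{r(t)}{r(s)}(\mathbb T_s-c)$ for all $s,t\in I$. Then $k\equiv0$ on every $\mathbb T_t$, and: 1. for triods, $\mathbb T_t$ is, for all $t\in I$, one and the same union of three half-lines from $c$ forming angles of $120$ degrees, and its 3-point is $c$; 2. for curves without end points, $\mathbb T_t$ is, for all $t\in I$, one and the same straight line through $c$; 3. for curves with one end point, every $\mathbb T_t$ is a half-line, with a direction independent of $t$, contained in a line through $c$; if the end point is kept fixed during the flow, then $\mathbb T_t$ is, for all $t\in I$, one and the same half-line from $c$. -/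

import Mathlib

open Set

/-- The Euclidean plane. -/
abbrev Plane := EuclideanSpace ℝ (Fin 2)

noncomputable section

/-- Counterclockwise rotation by `π / 2`. -/
def rot (v : Plane) : Plane := !₂[-v 1, v 0]

/-! Curves are maps `σ : ℝ → Plane` restricted to a domain `D` (an interval); all derivatives are
taken within `D`, hence one-sided at the end points of `D`. -/

/-- `σ_x`. -/
def vel (σ : ℝ → Plane) (D : Set ℝ) (x : ℝ) : Plane := derivWithin σ D x

/-- `σ_xx`. -/
def acc (σ : ℝ → Plane) (D : Set ℝ) (x : ℝ) : Plane := derivWithin (vel σ D) D x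

/-- The unit tangent `τ = σ_x / |σ_x|`. -/
def tangent (σ : ℝ → Plane) (D : Set ℝ) (x : ℝ) : Plane := ‖vel σ D x‖⁻¹ • vel σ D x

/-- The unit normal `ν`, the rotation of `τ` by `π / 2`. -/
def normal (σ : ℝ → Plane) (D : Set ℝ) (x : ℝ) : Plane := rot (tangent σ D x)

/-- The curvature `k = ⟨σ_xx | ν⟩ / |σ_x|²`. -/
def curvature (σ : ℝ → Plane) (D : Set ℝ) (x : ℝ) : ℝ :=
  inner ℝ (acc σ D x) (normal σ D x) / ‖vel σ D x‖ ^ 2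

/-- A regular curve of class `C²` on `D`. -/
def IsRegularCurve (σ : ℝ → Plane) (D : Set ℝ) : Prop :=
  ContDiffOn ℝ 2 σ D ∧ ∀ x ∈ D, vel σ D x ≠ 0

/-- The shrinker equation `k = -⟨x | ν⟩` at every point of the curve. -/
def IsShrinker (σ : ℝ → Plane) (D : Set ℝ) : Prop :=
  ∀ x ∈ D, curvature σ D x = -inner ℝ (σ x) (normal σ D x)

/-- A complete embedded curve without end points: regular, without self-intersections and of
infinite length in both directions. -/
structure IsCompleteLine (σ : ℝ → Plane) : Prop where
  regular : IsRegularCurve σ univ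
  injective : Function.Injective σ
  length_right : eVariationOn σ (Ici 0) = ⊤
  length_left : eVariationOn σ (Iic 0) = ⊤

/-- A complete embedded curve with exactly one end point, `σ 0`. -/
structure IsCompleteHalfLine (σ : ℝ → Plane) : Prop where
  regular : IsRegularCurve σ (Ici 0)
  injective : InjOn σ (Ici 0)
  length : eVariationOn σ (Ici 0) = ⊤

/-- The conditions on three curves, parametrized on `D ∋ 0`, to form an embedded triod: each of
them is regular and injective, they meet exactly at the common initial point (the 3-point), and
there they form angles of 120 degrees. -/
structure IsTriodOn (σ : Fin 3 → ℝ → Plane) (D : Set ℝ) : Prop where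
  regular : ∀ i, IsRegularCurve (σ i) D
  injective : ∀ i, InjOn (σ i) D
  common : ∀ i j, σ i 0 = σ j 0
  meet : ∀ i j, i ≠ j → ∀ x ∈ D, ∀ y ∈ D, σ i x = σ j y → x = 0 ∧ y = 0
  angles : ∑ i, tangent (σ i) D 0 = 0

/-- A complete embedded triod without end points: its three edges, parametrized on `[0, ∞)`, have
infinite length. -/
structure IsCompleteTriod (σ : Fin 3 → ℝ → Plane) : Prop where
  triod : IsTriodOn σ (Ici 0)
  length : ∀ i, eVariationOn (σ i) (Ici 0) = ⊤

/-- The subset of the plane covered by a triod. -/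
def triodSet (σ : Fin 3 → ℝ → Plane) : Set Plane := ⋃ i, σ i '' Ici 0

/-- The closed half-line from `p` in the direction `v`. -/
def ray (p v : Plane) : Set Plane := (fun s : ℝ => p + s • v) '' Ici 0

/-- The straight line through `p` in the direction `v`. -/
def straightLine (p v : Plane) : Set Plane := range (fun s : ℝ => p + s • v)

/-- The three unit vectors `v i` form angles of 120 degrees with each other. -/
def Angles120 (v : Fin 3 → Plane) : Prop :=
  (∀ i, ‖v i‖ = 1) ∧
    ∀ i j, i ≠ j → InnerProductGeometry.angle (v i) (v j) = 2 * Real.pi / 3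

/-- The curves `γ · t`, `t ∈ J`, parametrized on `D`, move by curvature: the points have a velocity,
whose normal component is the curvature. The tangential component is free, so that in particular
the evolution `γ_t = γ_xx / |γ_x|²` is covered. -/
def MovesByCurvature (γ : ℝ → ℝ → Plane) (D J : Set ℝ) : Prop :=
  ∀ t ∈ J, ∀ x ∈ D, ∃ w : Plane, HasDerivWithinAt (fun s => γ x s) w J t ∧
    inner ℝ w (normal (fun y => γ y t) D x) = curvature (fun y => γ y t) D x

/-- The times of `I` at distance less than `ε` from `t₀`. -/
def timesNear (I : Set ℝ) (t₀ ε : ℝ) : Set ℝ := I ∩ Ioo (t₀ - ε) (t₀ + ε)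

/-- Around the space-time point `(p, t₀)`, the sets `T t`, `t ∈ I`, are parametrized by a family of
embedded arcs moving by curvature and having `p` in the interior of the arc at the time `t₀`. The
end points of the arcs are free to move. -/
def IsCurveFlowNear (T : ℝ → Set Plane) (I : Set ℝ) (t₀ : ℝ) (p : Plane) : Prop :=
  ∃ (U : Set Plane) (ε : ℝ) (γ : ℝ → ℝ → Plane), IsOpen U ∧ p ∈ U ∧ 0 < ε ∧
    p ∈ (fun x => γ x t₀) '' Ioo (-1) 1 ∧
    (∀ t ∈ timesNear I t₀ ε,
      IsRegularCurve (fun x => γ x t) (Icc (-1) 1) ∧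
      InjOn (fun x => γ x t) (Icc (-1) 1) ∧
      T t ∩ U ⊆ (fun x => γ x t) '' Icc (-1) 1 ∧
      (fun x => γ x t) '' Icc (-1) 1 ⊆ T t) ∧
    MovesByCurvature γ (Icc (-1) 1) (timesNear I t₀ ε)

/-- Around the space-time point `(p, t₀)`, the sets `T t`, `t ∈ I`, are parametrized by a family of
embedded arcs moving by curvature, `γ 0 t₀ = p`, and `γ 0 t` is the end point `P t`. -/
def IsEndPointFlowNear (T : ℝ → Set Plane) (P : ℝ → Plane) (I : Set ℝ) (t₀ : ℝ) (p : Plane) :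
    Prop :=
  ∃ (U : Set Plane) (ε : ℝ) (γ : ℝ → ℝ → Plane), IsOpen U ∧ p ∈ U ∧ 0 < ε ∧
    γ 0 t₀ = p ∧
    (∀ t ∈ timesNear I t₀ ε,
      IsRegularCurve (fun x => γ x t) (Icc 0 1) ∧
      InjOn (fun x => γ x t) (Icc 0 1) ∧
      γ 0 t = P t ∧
      T t ∩ U ⊆ (fun x => γ x t) '' Icc 0 1 ∧
      (fun x => γ x t) '' Icc 0 1 ⊆ T t) ∧
    MovesByCurvature γ (Icc 0 1) (timesNear I t₀ ε)

/-- Around the space-time point `(p, t₀)`, the sets `T t`, `t ∈ I`, are parametrized by a family of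
embedded triods (with end points free to move) whose edges move by curvature and whose 3-point at
the time `t₀` is `p`. -/
def IsTriodFlowNear (T : ℝ → Set Plane) (I : Set ℝ) (t₀ : ℝ) (p : Plane) : Prop :=
  ∃ (U : Set Plane) (ε : ℝ) (γ : Fin 3 → ℝ → ℝ → Plane), IsOpen U ∧ p ∈ U ∧ 0 < ε ∧
    (∀ i, γ i 0 t₀ = p) ∧
    (∀ t ∈ timesNear I t₀ ε,
      IsTriodOn (fun i x => γ i x t) (Icc 0 1) ∧
      T t ∩ U ⊆ ⋃ i, (fun x => γ i x t) '' Icc 0 1 ∧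
      (⋃ i, (fun x => γ i x t) '' Icc 0 1) ⊆ T t) ∧
    ∀ i, MovesByCurvature (γ i) (Icc 0 1) (timesNear I t₀ ε)

/-- The complete embedded triods without end points given by `σ t`, `t ∈ I`, flow by curvature. The
parametrizations `σ t` of the single triods are not related to each other; the flow is expressed by
local parametrizations in space and time. -/
structure IsTriodFlow (σ : ℝ → Fin 3 → ℝ → Plane) (I : Set ℝ) : Prop where
  slice : ∀ t ∈ I, IsCompleteTriod (σ t)
  edges : ∀ t ∈ I, ∀ i, ∀ x > 0, IsCurveFlowNear (fun s => triodSet (σ s)) I t (σ t i x)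
  junction : ∀ t ∈ I, IsTriodFlowNear (fun s => triodSet (σ s)) I t (σ t 0 0)

/-- The complete embedded curves without end points given by `σ t`, `t ∈ I`, flow by curvature. -/
structure IsLineFlow (σ : ℝ → ℝ → Plane) (I : Set ℝ) : Prop where
  slice : ∀ t ∈ I, IsCompleteLine (σ t)
  points : ∀ t ∈ I, ∀ x, IsCurveFlowNear (fun s => range (σ s)) I t (σ t x)

/-- The complete embedded curves with one end point given by `σ t`, `t ∈ I`, flow by curvature. The
end point `σ t 0` is allowed to move. -/
structure IsHalfLineFlow (σ : ℝ → ℝ → Plane) (I : Set ℝ) : Prop where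
  slice : ∀ t ∈ I, IsCompleteHalfLine (σ t)
  points : ∀ t ∈ I, ∀ x > 0, IsCurveFlowNear (fun s => σ s '' Ici 0) I t (σ t x)
  endPoint : ∀ t ∈ I, IsEndPointFlowNear (fun s => σ s '' Ici 0) (fun s => σ s 0) I t (σ t 0)

/-- The sets `T t`, `t ∈ I`, shrink homothetically around `c`. -/
def ShrinksHomothetically (T : ℝ → Set Plane) (I : Set ℝ) (c : Plane) : Prop :=
  ∃ r : ℝ → ℝ, (∀ t ∈ I, 0 < r t) ∧ DifferentiableOn ℝ r I ∧ StrictAntiOn r I ∧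
    ∀ s ∈ I, ∀ t ∈ I, T t = AffineMap.homothety c (r t / r s) '' T s

end

/-! Everything rests on one half-infinite embedded curve. Along a shrinker, `k e^{-|x|²/2}` is a
constant `C`. If `C = 0`, the curve is straight. If `C ≠ 0`, a reflection makes `C > 0`. With `y =
|x|²/2` and `U = ⟨x | τ⟩`, arclength differentiation gives `y' = U`, `U' = 1 - C² e^{2y}`, an
oscillator with decreasing force, and `U² + k² = 2y` confines `y` to a bounded set. Infinite length
then forces `y` to attain both its maximum and its minimum, while the polar angle of `x` grows
without bound. Compare `y` at the polar angles `a` and `a + 2π`: the difference is nonpositive where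
`y` is maximal and nonnegative where it is minimal, so it vanishes somewhere. There the curve meets
itself, contrary to embeddedness (`ShrinkerSystem.self_intersection`). No classification of
shrinkers is needed, and since only one end is used, lines, half-lines and the edges of triods are
treated alike.

Once `k = 0`, the equation reads `⟨x - c | ν⟩ = 0`, so the supporting line passes through the centre
`c`. For a triod whose 3-point is not `c`, all three unit tangents would be parallel to one vector,
against their zero sum.

A homothetically shrinking flow satisfies `k = -λ ⟨x - c | ν⟩` with `λ = -r'/r ≥ 0`
(`IsCurveFlowNear.curvature_eq`): a moving point rescaled back to time `t₀` stays on the curve of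
time `t₀`, so its velocity is tangent there. Where `λ = 0` this is already `k = 0`; where `λ > 0`
the argument above applies after scaling. Since `r` is not constant, `λ > 0` at some time, which
fixes the position relative to `c`; homotheties carry it to all times. -/

/-! ### Linear algebra of the plane. -/

theorem inner_plane (a b : Plane) : inner ℝ a b = a 0 * b 0 + a 1 * b 1 := by
  simp [PiLp.inner_apply, Fin.sum_univ_two, mul_comm]

theorem norm_sq_plane (a : Plane) : ‖a‖ ^ 2 = a 0 ^ 2 + a 1 ^ 2 := by
  rw [← real_inner_self_eq_norm_sq, inner_plane]; ring

@[simp] theorem rot_apply_zero (v : Plane) : rot v 0 = -v 1 := by simp [rot]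

@[simp] theorem rot_apply_one (v : Plane) : rot v 1 = v 0 := by simp [rot]

theorem plane_ext {a b : Plane} (h0 : a 0 = b 0) (h1 : a 1 = b 1) : a = b := by
  ext i; fin_cases i <;> assumption

theorem eq_smul_of_inner_rot_eq_zero {v a : Plane} (hv : ‖v‖ = 1) (h : inner ℝ a (rot v) = 0) :
    a = (inner ℝ a v : ℝ) • v := by
  have hn := norm_sq_plane v
  rw [hv] at hn
  rw [inner_plane] at h
  simp only [rot_apply_zero, rot_apply_one] at h
  apply plane_ext <;> simp only [inner_plane, PiLp.smul_apply, smul_eq_mul]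
  · linear_combination a 0 * hn - v 1 * h
  · linear_combination a 1 * hn + v 0 * h

theorem eq_smul_rot_of_inner_eq_zero {v a : Plane} (hv : ‖v‖ = 1) (h : inner ℝ v a = 0) :
    a = (inner ℝ a (rot v) : ℝ) • rot v := by
  have hn := norm_sq_plane v
  rw [hv] at hn
  rw [inner_plane] at h
  apply plane_ext <;>
    simp only [inner_plane, PiLp.smul_apply, smul_eq_mul, rot_apply_zero, rot_apply_one]
  · linear_combination a 0 * hn + v 0 * h
  · linear_combination a 1 * hn + v 1 * h

theorem norm_rot (v : Plane) : ‖rot v‖ = ‖v‖ := by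
  have h : ‖rot v‖ ^ 2 = ‖v‖ ^ 2 := by
    rw [norm_sq_plane, norm_sq_plane]; simp; ring
  exact (sq_eq_sq₀ (norm_nonneg _) (norm_nonneg _)).1 h

/-! ### Regular curves and their Frenet formula. -/

section Regular

variable {σ : ℝ → Plane} {D : Set ℝ} {x : ℝ}

theorem IsRegularCurve.hasDerivWithinAt (h : IsRegularCurve σ D) (hx : x ∈ D) :
    HasDerivWithinAt σ (vel σ D x) D x :=
  ((h.1.differentiableOn (by norm_num)) x hx).hasDerivWithinAt

theorem IsRegularCurve.contDiffOn_vel (h : IsRegularCurve σ D) (hD : UniqueDiffOn ℝ D) :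
    ContDiffOn ℝ 1 (vel σ D) D :=
  h.1.derivWithin hD (by norm_num)

theorem IsRegularCurve.hasDerivWithinAt_vel (h : IsRegularCurve σ D) (hD : UniqueDiffOn ℝ D)
    (hx : x ∈ D) : HasDerivWithinAt (vel σ D) (acc σ D x) D x :=
  (((h.contDiffOn_vel hD).differentiableOn (by norm_num)) x hx).hasDerivWithinAt

theorem IsRegularCurve.continuousOn_acc (h : IsRegularCurve σ D) (hD : UniqueDiffOn ℝ D) :
    ContinuousOn (acc σ D) D :=
  (h.contDiffOn_vel hD).continuousOn_derivWithin hD (by norm_num)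

theorem IsRegularCurve.norm_vel_pos (h : IsRegularCurve σ D) (hx : x ∈ D) :
    0 < ‖vel σ D x‖ := norm_pos_iff.2 (h.2 x hx)

theorem IsRegularCurve.norm_tangent (h : IsRegularCurve σ D) (hx : x ∈ D) :
    ‖tangent σ D x‖ = 1 := by
  rw [tangent, norm_smul, norm_inv, norm_norm, inv_mul_cancel₀ (h.norm_vel_pos hx).ne']

theorem IsRegularCurve.norm_normal (h : IsRegularCurve σ D) (hx : x ∈ D) :
    ‖normal σ D x‖ = 1 := by
  rw [normal, norm_rot, h.norm_tangent hx]

theorem IsRegularCurve.vel_eq (h : IsRegularCurve σ D) (hx : x ∈ D) :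
    vel σ D x = ‖vel σ D x‖ • tangent σ D x := by
  rw [tangent, smul_smul, mul_inv_cancel₀ (h.norm_vel_pos hx).ne', one_smul]

theorem inner_vel_normal (σ : ℝ → Plane) (D : Set ℝ) (x : ℝ) :
    inner ℝ (vel σ D x) (normal σ D x) = 0 := by
  rw [normal, tangent, inner_plane]; simp; ring

theorem IsRegularCurve.inner_acc_normal (h : IsRegularCurve σ D) (hx : x ∈ D) :
    inner ℝ (acc σ D x) (normal σ D x) = curvature σ D x * ‖vel σ D x‖ ^ 2 := by
  rw [curvature, div_mul_cancel₀ _ (pow_ne_zero 2 (h.norm_vel_pos hx).ne')]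

theorem IsRegularCurve.continuousOn_tangent (h : IsRegularCurve σ D) (hD : UniqueDiffOn ℝ D) :
    ContinuousOn (tangent σ D) D :=
  ((h.contDiffOn_vel hD).continuousOn.norm.inv₀ fun _ hx => (h.norm_vel_pos hx).ne').smul
    (h.contDiffOn_vel hD).continuousOn

theorem continuous_rot : Continuous rot := by
  unfold rot
  refine (PiLp.continuous_toLp 2 _).comp (continuous_pi fun i => ?_)
  fin_cases i <;> simp <;> fun_prop

theorem IsRegularCurve.continuousOn_normal (h : IsRegularCurve σ D) (hD : UniqueDiffOn ℝ D) :
    ContinuousOn (normal σ D) D :=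
  continuous_rot.comp_continuousOn (h.continuousOn_tangent hD)

theorem IsRegularCurve.continuousOn_curvature (h : IsRegularCurve σ D) (hD : UniqueDiffOn ℝ D) :
    ContinuousOn (curvature σ D) D :=
  ((h.continuousOn_acc hD).inner (h.continuousOn_normal hD)).div
    ((h.contDiffOn_vel hD).continuousOn.norm.pow 2)
    fun _ hx => pow_ne_zero 2 (h.norm_vel_pos hx).ne'

/-- The first Frenet formula `τ_x = |σ_x| k ν`. -/
theorem IsRegularCurve.hasDerivWithinAt_tangent (h : IsRegularCurve σ D) (hD : UniqueDiffOn ℝ D)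
    (hx : x ∈ D) :
    HasDerivWithinAt (tangent σ D) ((‖vel σ D x‖ * curvature σ D x) • normal σ D x) D x := by
  have hN := h.norm_vel_pos hx
  have hv := h.hasDerivWithinAt_vel hD hx
  have hsq := hv.norm_sq
  have hn : HasDerivWithinAt (fun y => ‖vel σ D y‖)
      (2 * inner ℝ (vel σ D x) (acc σ D x) / (2 * ‖vel σ D x‖)) D x := by
    have := hsq.sqrt (pow_ne_zero 2 hN.ne')
    simpa [Real.sqrt_sq (norm_nonneg _)] using this
  have ht := (hn.inv hN.ne').smul hv
  refine ht.congr_deriv ?_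
  have hNsq := norm_sq_plane (vel σ D x)
  rw [curvature, normal, tangent, Pi.inv_apply]
  generalize vel σ D x = v at *
  generalize acc σ D x = a at *
  generalize ‖v‖ = N at *
  apply plane_ext <;> simp [inner_plane] <;> field_simp
  · linear_combination a 0 * hNsq
  · linear_combination a 1 * hNsq

end Regular

/-! ### Calculus on the half-line. -/

theorem exists_antideriv_Ici {h : ℝ → ℝ} (hh : ContinuousOn h (Ici 0)) :
    ∃ H : ℝ → ℝ, H 0 = 0 ∧ ∀ x ∈ Ici (0 : ℝ), HasDerivWithinAt H (h x) (Ici 0) x := by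
  have hc : Continuous fun t => h (max t 0) :=
    hh.comp_continuous (by fun_prop) fun x => mem_Ici.2 (le_max_right _ _)
  refine ⟨fun x => ∫ t in (0 : ℝ)..x, h (max t 0), by simp, fun x hx => ?_⟩
  have := (hc.integral_hasStrictDerivAt 0 x).hasDerivAt.hasDerivWithinAt (s := Ici 0)
  rwa [max_eq_left (show (0 : ℝ) ≤ x from hx)] at this

section Monotone

variable {f f' : ℝ → ℝ} {a b : ℝ}

theorem le_of_deriv_nonneg (hf : ∀ x ∈ Ici (0 : ℝ), HasDerivWithinAt f (f' x) (Ici 0) x)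
    (ha : 0 ≤ a) (hab : a ≤ b) (h : ∀ x, a < x → x < b → 0 ≤ f' x) : f a ≤ f b := by
  have hsub : Icc a b ⊆ Ici 0 := fun x hx => ha.trans hx.1
  refine monotoneOn_of_hasDerivWithinAt_nonneg (f' := f') (convex_Icc a b)
    (fun x hx => ((hf x (hsub hx)).mono hsub).continuousWithinAt) (fun x hx => ?_) (fun x hx => ?_)
    (left_mem_Icc.2 hab) (right_mem_Icc.2 hab) hab
  · exact (hf x (hsub (interior_subset hx))).mono (interior_subset.trans hsub)
  · rw [interior_Icc] at hx
    exact h x hx.1 hx.2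

theorem lt_of_deriv_pos (hf : ∀ x ∈ Ici (0 : ℝ), HasDerivWithinAt f (f' x) (Ici 0) x)
    (ha : 0 ≤ a) (hab : a < b) (h : ∀ x, a < x → x < b → 0 < f' x) : f a < f b := by
  have hsub : Icc a b ⊆ Ici 0 := fun x hx => ha.trans hx.1
  refine strictMonoOn_of_hasDerivWithinAt_pos (f' := f') (convex_Icc a b)
    (fun x hx => ((hf x (hsub hx)).mono hsub).continuousWithinAt) (fun x hx => ?_) (fun x hx => ?_)
    (left_mem_Icc.2 hab.le) (right_mem_Icc.2 hab.le) hab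
  · exact (hf x (hsub (interior_subset hx))).mono (interior_subset.trans hsub)
  · rw [interior_Icc] at hx
    exact h x hx.1 hx.2

theorem eq_of_deriv_zero (hf : ∀ x ∈ Ici (0 : ℝ), HasDerivWithinAt f 0 (Ici 0) x)
    (ha : 0 ≤ a) : f a = f 0 := by
  refine le_antisymm ?_ (le_of_deriv_nonneg hf le_rfl ha fun _ _ _ => le_rfl)
  have := le_of_deriv_nonneg (f := fun x => -f x) (f' := fun _ => -0)
    (fun x hx => (hf x hx).neg) le_rfl ha (by simp)
  linarith

end Monotone

/-! ### Turning points of an oscillator with decreasing force. -/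

/-- The oscillator `y' = V U`, `U' = V g(y)` with decreasing force `g`, run through an infinite
amount of time `L`, `L' = V`. -/
structure Oscillator (y U V L g : ℝ → ℝ) : Prop where
  hasDeriv_y : ∀ x ∈ Ici (0 : ℝ), HasDerivWithinAt y (V x * U x) (Ici 0) x
  hasDeriv_U : ∀ x ∈ Ici (0 : ℝ), HasDerivWithinAt U (V x * g (y x)) (Ici 0) x
  hasDeriv_L : ∀ x ∈ Ici (0 : ℝ), HasDerivWithinAt L (V x) (Ici 0) x
  V_pos : ∀ x ∈ Ici (0 : ℝ), 0 < V x
  L_unbounded : ∀ M, ∃ x ∈ Ici (0 : ℝ), M ≤ L x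
  anti : Antitone g

namespace Oscillator

variable {y U V L g : ℝ → ℝ}

theorem neg (h : Oscillator y U V L g) :
    Oscillator (fun x => -y x) (fun x => -U x) V L (fun z => -g (-z)) where
  hasDeriv_y x hx := (h.hasDeriv_y x hx).neg.congr_deriv (by ring)
  hasDeriv_U x hx := (h.hasDeriv_U x hx).neg.congr_deriv (by simp)
  hasDeriv_L := h.hasDeriv_L
  V_pos := h.V_pos
  L_unbounded := h.L_unbounded
  anti a b hab := neg_le_neg (h.anti (neg_le_neg hab))

theorem exists_L_ge (h : Oscillator y U V L g) (s M : ℝ) :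
    ∃ x, s ≤ x ∧ M ≤ L x := by
  obtain ⟨x, hx, hM⟩ := h.L_unbounded M
  rcases le_total s x with hsx | hsx
  · exact ⟨x, hsx, hM⟩
  · exact ⟨s, le_rfl, hM.trans (le_of_deriv_nonneg h.hasDeriv_L hx hsx
      fun z hz _ => (h.V_pos z (le_of_lt (lt_of_le_of_lt hx hz))).le)⟩

/-- If `U ≤ 0` from `s₀` on, `y` decreases and the force `g (y)` increases. A positive force would
drive `U` to infinity, so the force stays nonpositive and `U` decreases; a negative `U` would then
drive `y` below `m`. Only `U = 0` remains, an equilibrium, which `hne` excludes. -/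
theorem exists_pos (h : Oscillator y U V L g) {m : ℝ} (hm : ∀ x ∈ Ici (0 : ℝ), m ≤ y x)
    (hne : ∀ x ∈ Ici (0 : ℝ), U x = 0 → g (y x) ≠ 0) {s₀ : ℝ} (hs₀ : 0 ≤ s₀) :
    ∃ s, s₀ ≤ s ∧ 0 < U s := by
  by_contra! hU
  have hy : ∀ s t, s₀ ≤ s → s ≤ t → y t ≤ y s := fun s t hs hst => by
    have := le_of_deriv_nonneg (fun x hx => (h.hasDeriv_y x hx).neg) (hs₀.trans hs) hst
      fun x hx _ => by
        have := h.V_pos x ((hs₀.trans hs).trans hx.le)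
        nlinarith [hU x (hs.trans hx.le)]
    simpa using this
  have hg : ∀ s, s₀ ≤ s → g (y s) ≤ 0 := by
    intro s hs
    by_contra! hpos
    obtain ⟨t, hst, ht⟩ := h.exists_L_ge s (L s + (1 - U s) / g (y s))
    have := le_of_deriv_nonneg (fun x hx => (h.hasDeriv_U x hx).sub
      ((h.hasDeriv_L x hx).const_mul (g (y s)))) (hs₀.trans hs) hst fun x hx _ => by
        have := h.V_pos x ((hs₀.trans hs).trans hx.le)
        nlinarith [h.anti (hy s x hs hx.le)]
    simp only [Pi.sub_apply] at this
    have h2 : g (y s) * (L s + (1 - U s) / g (y s)) ≤ g (y s) * L t :=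
      mul_le_mul_of_nonneg_left ht hpos.le
    rw [mul_add, mul_div_cancel₀ _ hpos.ne'] at h2
    linarith [hU t (hs.trans hst)]
  have hU0 : ∀ s, s₀ ≤ s → U s = 0 := by
    intro s hs
    refine le_antisymm (hU s hs) ?_
    by_contra! hneg
    have hanti : ∀ x, s ≤ x → U x ≤ U s := fun x hx => by
      have := le_of_deriv_nonneg (fun x hx => (h.hasDeriv_U x hx).neg) (hs₀.trans hs) hx
        fun z hz _ => by
          have := h.V_pos z ((hs₀.trans hs).trans hz.le)
          nlinarith [hg z (hs.trans hz.le)]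
      simpa using this
    obtain ⟨t, hst, ht⟩ := h.exists_L_ge s (L s + (y s - m + 1) / (-U s))
    have := le_of_deriv_nonneg (fun x hx => ((h.hasDeriv_L x hx).const_mul (U s)).sub
      (h.hasDeriv_y x hx)) (hs₀.trans hs) hst fun x hx _ => by
        have := h.V_pos x ((hs₀.trans hs).trans hx.le)
        nlinarith [hanti x hx.le]
    simp only [Pi.sub_apply] at this
    have hpos : 0 < -U s := by linarith
    have h2 : -U s * (L s + (y s - m + 1) / (-U s)) ≤ -U s * L t :=
      mul_le_mul_of_nonneg_left ht hpos.le
    rw [mul_add, mul_div_cancel₀ _ hpos.ne'] at h2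
    linarith [hm t ((hs₀.trans hs).trans hst)]
  have h1 : HasDerivWithinAt U (V s₀ * g (y s₀)) (Ici s₀) s₀ :=
    (h.hasDeriv_U s₀ hs₀).mono (Ici_subset_Ici.2 hs₀)
  have h2 : HasDerivWithinAt U 0 (Ici s₀) s₀ :=
    (hasDerivWithinAt_const s₀ (Ici s₀) (0 : ℝ)).congr (fun x hx => hU0 x hx) (hU0 s₀ le_rfl)
  have h3 := (uniqueDiffOn_Ici s₀ s₀ self_mem_Ici).eq_deriv _ h1 h2
  rcases mul_eq_zero.1 h3 with h4 | h4
  · exact (h.V_pos s₀ hs₀).ne' h4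
  · exact hne s₀ hs₀ (hU0 s₀ le_rfl) h4

/-- `U` is positive at some `s` and negative at some later time; `y` rises from `s` up to the first
zero of `U`. -/
theorem exists_turning_above (h : Oscillator y U V L g) {m M : ℝ}
    (hm : ∀ x ∈ Ici (0 : ℝ), m ≤ y x) (hM : ∀ x ∈ Ici (0 : ℝ), y x ≤ M)
    (hne : ∀ x ∈ Ici (0 : ℝ), U x = 0 → g (y x) ≠ 0) :
    ∃ s ∈ Ici (0 : ℝ), ∃ z ∈ Ici (0 : ℝ), U z = 0 ∧ y s < y z := by
  obtain ⟨s, hs, hUs⟩ := h.exists_pos hm hne le_rfl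
  obtain ⟨t, hst, hUt⟩ := h.neg.exists_pos (m := -M) (fun x hx => neg_le_neg (hM x hx))
    (fun x hx hUx => by simpa using hne x hx (by simpa using hUx)) hs
  have hcont : ContinuousOn U (Icc s t) := fun x hx =>
    ((h.hasDeriv_U x (hs.trans hx.1)).continuousWithinAt).mono fun z hz => hs.trans hz.1
  have hclosed : IsClosed (Icc s t ∩ U ⁻¹' Iic 0) :=
    hcont.preimage_isClosed_of_isClosed isClosed_Icc isClosed_Iic
  obtain ⟨z, ⟨hz, hUz⟩, hleast⟩ := (isCompact_Icc.of_isClosed_subset hclosed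
    inter_subset_left).exists_isLeast ⟨t, right_mem_Icc.2 hst, by simpa using hUt.le⟩
  have hpos : ∀ x, s ≤ x → x < z → 0 < U x := fun x hx hxz => by
    by_contra! hneg
    exact absurd (hleast ⟨⟨hx, hxz.le.trans hz.2⟩, hneg⟩) (not_le.2 hxz)
  have hsz : s < z := lt_of_le_of_ne hz.1 fun heq => by
    subst heq; exact absurd hUz (not_le.2 hUs)
  refine ⟨s, hs, z, hs.trans hz.1, le_antisymm hUz ?_, ?_⟩
  · have hcz : ContinuousWithinAt U (Ico s z) z :=
      (hcont z hz).mono fun x hx => ⟨hx.1, hx.2.le.trans hz.2⟩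
    have hcl : z ∈ closure (Ico s z) := by
      rw [closure_Ico hsz.ne]; exact right_mem_Icc.2 hsz.le
    exact (closure_minimal (t := Ici 0) (by
      rintro _ ⟨x, hx, rfl⟩; exact (hpos x hx.1 hx.2).le) isClosed_Ici) (hcz.mem_closure_image hcl)
  · exact lt_of_deriv_pos h.hasDeriv_y hs hsz fun x hx hxz =>
      mul_pos (h.V_pos x (hs.trans hx.le)) (hpos x hx.le hxz)

theorem exists_turning_below (h : Oscillator y U V L g) {m M : ℝ}
    (hm : ∀ x ∈ Ici (0 : ℝ), m ≤ y x) (hM : ∀ x ∈ Ici (0 : ℝ), y x ≤ M)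
    (hne : ∀ x ∈ Ici (0 : ℝ), U x = 0 → g (y x) ≠ 0) :
    ∃ s ∈ Ici (0 : ℝ), ∃ z ∈ Ici (0 : ℝ), U z = 0 ∧ y z < y s := by
  obtain ⟨s, hs, z, hz, hU, hy⟩ := h.neg.exists_turning_above (m := -M) (M := -m)
    (fun x hx => neg_le_neg (hM x hx)) (fun x hx => neg_le_neg (hm x hx))
    (fun x hx hUx => by simpa using hne x hx (by simpa using hUx))
  exact ⟨s, hs, z, hz, by simpa using hU, by simpa using hy⟩

end Oscillator

/-- Extended by the identity to the negative numbers, `φ` is an order isomorphism of `ℝ`, and these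
have continuous inverses. This serves to parametrize a curve by its polar angle. -/
theorem exists_continuousOn_rightInverse_Ici {φ : ℝ → ℝ} (hc : ContinuousOn φ (Ici 0))
    (hm : StrictMonoOn φ (Ici 0)) (h0 : φ 0 = 0) (hunb : ∀ M, ∃ x ∈ Ici (0 : ℝ), M ≤ φ x) :
    ∃ ψ : ℝ → ℝ, Continuous ψ ∧ ∀ y ∈ Ici (0 : ℝ), ψ y ∈ Ici (0 : ℝ) ∧ φ (ψ y) = y := by
  set F : ℝ → ℝ := fun x => φ (max x 0) + min x 0 with hF
  have hFpos : ∀ x, 0 ≤ x → F x = φ x := fun x hx => by simp [hF, hx]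
  have hFneg : ∀ x, x ≤ 0 → F x = x := fun x hx => by simp [hF, hx, h0]
  have hmono : StrictMono F := by
    intro x y hxy
    rcases le_total 0 x with hx | hx
    · rw [hFpos x hx, hFpos y (hx.trans hxy.le)]
      exact hm hx (hx.trans hxy.le) hxy
    · rcases le_total 0 y with hy | hy
      · rw [hFneg x hx, hFpos y hy]
        rcases hy.eq_or_lt with rfl | hy
        · rwa [h0]
        · exact hx.trans_lt (h0 ▸ hm self_mem_Ici hy.le hy)
      · rwa [hFneg x hx, hFneg y hy]
  have hsurj : Function.Surjective F := by
    intro y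
    rcases le_total 0 y with hy | hy
    · obtain ⟨b, hb, hyb⟩ := hunb y
      obtain ⟨x, hx, hxy⟩ := intermediate_value_Icc (show (0 : ℝ) ≤ b from hb)
        (hc.mono fun z hz => hz.1) ⟨h0.symm ▸ hy, hyb⟩
      exact ⟨x, by rw [hFpos x hx.1, hxy]⟩
    · exact ⟨y, hFneg y hy⟩
  let e := hmono.orderIsoOfSurjective F hsurj
  have he : ∀ y, F (e.symm y) = y := e.apply_symm_apply
  refine ⟨e.symm, e.symm.continuous, fun y hy => ?_⟩
  have hpos : 0 ≤ e.symm y := by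
    by_contra! hneg
    have := he y
    rw [hFneg _ hneg.le] at this
    exact absurd hy (not_le.2 (this ▸ hneg))
  exact ⟨hpos, by rw [← hFpos _ hpos, he]⟩

/-! ### Self-intersection of curved shrinkers. -/

/-- The Frenet system of a self-shrinker `X = (A, B)` with unit tangent `(P, Q)`, speed `V` and
curvature `A Q - B P`, of infinite length `L`. -/
structure ShrinkerSystem (A B P Q V L : ℝ → ℝ) : Prop where
  hasDeriv_A : ∀ x ∈ Ici (0 : ℝ), HasDerivWithinAt A (V x * P x) (Ici 0) x
  hasDeriv_B : ∀ x ∈ Ici (0 : ℝ), HasDerivWithinAt B (V x * Q x) (Ici 0) x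
  hasDeriv_P : ∀ x ∈ Ici (0 : ℝ),
    HasDerivWithinAt P (-(V x * (A x * Q x - B x * P x) * Q x)) (Ici 0) x
  hasDeriv_Q : ∀ x ∈ Ici (0 : ℝ),
    HasDerivWithinAt Q (V x * (A x * Q x - B x * P x) * P x) (Ici 0) x
  unit : ∀ x ∈ Ici (0 : ℝ), P x ^ 2 + Q x ^ 2 = 1
  continuousOn_V : ContinuousOn V (Ici 0)
  V_pos : ∀ x ∈ Ici (0 : ℝ), 0 < V x
  hasDeriv_L : ∀ x ∈ Ici (0 : ℝ), HasDerivWithinAt L (V x) (Ici 0) x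
  L_unbounded : ∀ M, ∃ x ∈ Ici (0 : ℝ), M ≤ L x

namespace ShrinkerSystem

variable {A B P Q V L : ℝ → ℝ}

/-- The reflection in the first axis reverses the sign of the curvature, so that only positive
curvature needs to be considered. -/
theorem reflect (h : ShrinkerSystem A B P Q V L) :
    ShrinkerSystem A (fun x => -B x) P (fun x => -Q x) V L where
  hasDeriv_A := h.hasDeriv_A
  hasDeriv_B x hx := (h.hasDeriv_B x hx).neg.congr_deriv (by ring)
  hasDeriv_P x hx := (h.hasDeriv_P x hx).congr_deriv (by ring)
  hasDeriv_Q x hx := (h.hasDeriv_Q x hx).neg.congr_deriv (by ring)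
  unit x hx := by simpa using h.unit x hx
  continuousOn_V := h.continuousOn_V
  V_pos := h.V_pos
  hasDeriv_L := h.hasDeriv_L
  L_unbounded := h.L_unbounded

theorem hasDeriv_normSq (h : ShrinkerSystem A B P Q V L) {x : ℝ} (hx : x ∈ Ici (0 : ℝ)) :
    HasDerivWithinAt (fun x => (A x ^ 2 + B x ^ 2) / 2) (V x * (A x * P x + B x * Q x))
      (Ici 0) x :=
  ((((h.hasDeriv_A x hx).pow 2).add ((h.hasDeriv_B x hx).pow 2)).div_const 2).congr_deriv
    (by simp; ring)

theorem hasDeriv_U (h : ShrinkerSystem A B P Q V L) {x : ℝ} (hx : x ∈ Ici (0 : ℝ)) :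
    HasDerivWithinAt (fun x => A x * P x + B x * Q x)
      (V x * (1 - (A x * Q x - B x * P x) ^ 2)) (Ici 0) x :=
  (((h.hasDeriv_A x hx).mul (h.hasDeriv_P x hx)).add
    ((h.hasDeriv_B x hx).mul (h.hasDeriv_Q x hx))).congr_deriv (by
      linear_combination V x * h.unit x hx)

theorem hasDeriv_kappa (h : ShrinkerSystem A B P Q V L) {x : ℝ} (hx : x ∈ Ici (0 : ℝ)) :
    HasDerivWithinAt (fun x => A x * Q x - B x * P x)
      (V x * (A x * Q x - B x * P x) * (A x * P x + B x * Q x)) (Ici 0) x :=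
  (((h.hasDeriv_A x hx).mul (h.hasDeriv_Q x hx)).sub
    ((h.hasDeriv_B x hx).mul (h.hasDeriv_P x hx))).congr_deriv (by ring)

/-- The quantity `k e^{-|X|²/2}` is conserved. -/
theorem kappa_eq (h : ShrinkerSystem A B P Q V L) : ∃ C : ℝ, ∀ x ∈ Ici (0 : ℝ),
    A x * Q x - B x * P x = C * Real.exp ((A x ^ 2 + B x ^ 2) / 2) := by
  set F : ℝ → ℝ := fun x => (A x * Q x - B x * P x) * Real.exp (-((A x ^ 2 + B x ^ 2) / 2))
    with hF
  have hder : ∀ x ∈ Ici (0 : ℝ), HasDerivWithinAt F 0 (Ici 0) x := fun x hx =>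
    ((h.hasDeriv_kappa hx).mul (h.hasDeriv_normSq hx).neg.exp).congr_deriv (by
      simp only [Pi.neg_apply]; ring)
  refine ⟨F 0, fun x hx => ?_⟩
  rw [← eq_of_deriv_zero hder hx, hF]
  simp only
  rw [mul_assoc, ← Real.exp_add]
  simp

theorem self_intersection_of_pos (h : ShrinkerSystem A B P Q V L) {x₀ : ℝ} (hx₀ : x₀ ∈ Ici (0 : ℝ))
    (hpos : 0 < A x₀ * Q x₀ - B x₀ * P x₀) :
    ∃ x ∈ Ici (0 : ℝ), ∃ y ∈ Ici (0 : ℝ), x ≠ y ∧ A x = A y ∧ B x = B y := by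
  obtain ⟨C, hC⟩ := h.kappa_eq
  set κ : ℝ → ℝ := fun x => A x * Q x - B x * P x with hκ
  set U : ℝ → ℝ := fun x => A x * P x + B x * Q x with hU
  set y : ℝ → ℝ := fun x => (A x ^ 2 + B x ^ 2) / 2 with hy
  have hCpos : 0 < C := by
    rw [hC x₀ hx₀] at hpos
    exact pos_of_mul_pos_left hpos (Real.exp_pos _).le
  have hy0 : ∀ x, 0 ≤ y x := fun x => by positivity
  have hκC : ∀ x ∈ Ici (0 : ℝ), κ x = C * Real.exp (y x) := hC
  -- `U` and `κ` are, up to sign, the components of `X` in the frame `τ, ν`.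
  have hUκ : ∀ x ∈ Ici (0 : ℝ), U x ^ 2 + κ x ^ 2 = 2 * y x := fun x hx => by
    simp only [hU, hκ, hy]
    linear_combination (A x ^ 2 + B x ^ 2) * h.unit x hx
  have hCκ : ∀ x ∈ Ici (0 : ℝ), C ≤ κ x := fun x hx => by
    rw [hκC x hx]
    exact le_mul_of_one_le_right hCpos.le (Real.one_le_exp (hy0 x))
  have hκsq : ∀ x ∈ Ici (0 : ℝ), κ x ^ 2 ≤ 2 * y x := fun x hx => by
    nlinarith [hUκ x hx, sq_nonneg (U x)]
  have hypos : ∀ x ∈ Ici (0 : ℝ), 0 < y x := fun x hx => by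
    have := hCκ x hx
    nlinarith [hκsq x hx]
  -- From `C y ≤ C e^y = κ` and `κ² ≤ 2y`.
  have hyM : ∀ x ∈ Ici (0 : ℝ), y x ≤ 2 / C ^ 2 := fun x hx => by
    have h1 := Real.add_one_le_exp (y x)
    have h2 : C * y x ≤ κ x := by rw [hκC x hx]; nlinarith
    have h3 := hκsq x hx
    have h4 := hypos x hx
    have h5 : (C * y x) ^ 2 ≤ κ x ^ 2 := by gcongr
    rw [le_div_iff₀ (by positivity)]
    nlinarith
  have hosc : Oscillator y U V L (fun z => 1 - (C * Real.exp z) ^ 2) :=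
    { hasDeriv_y := fun x hx => h.hasDeriv_normSq hx
      hasDeriv_U := fun x hx => by
        rw [← hκC x hx]; exact h.hasDeriv_U hx
      hasDeriv_L := h.hasDeriv_L
      V_pos := h.V_pos
      L_unbounded := h.L_unbounded
      anti := fun a b hab => by
        have := Real.exp_le_exp.2 hab
        have h2 : (C * Real.exp a) ^ 2 ≤ (C * Real.exp b) ^ 2 := by gcongr
        simp only; linarith }
  -- At a turning point `κ² = 2y`, so `κ x ^ 2 ≤ 2 y x` becomes `y z e^{2(y x - y z)} ≤ y x`; the
  -- strict bound `1 + u < e^u` then gives the claim, that is `(y x - y z)(2 y z - 1) < 0`.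
  have hratio : ∀ x ∈ Ici (0 : ℝ), ∀ z ∈ Ici (0 : ℝ), U z = 0 → y x ≠ y z →
      y z * (1 + 2 * (y x - y z)) < y x := by
    intro x hx z hz hUz hne
    have h1 : κ x ^ 2 = κ z ^ 2 * Real.exp (2 * (y x - y z)) := by
      rw [hκC x hx, hκC z hz, mul_pow, mul_pow, ← Real.exp_nat_mul, ← Real.exp_nat_mul, mul_assoc,
        ← Real.exp_add]
      congr 2
      push_cast; ring
    have h2 := hUκ z hz
    rw [hUz] at h2
    have h3 := Real.add_one_lt_exp (x := 2 * (y x - y z))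
      (mul_ne_zero two_ne_zero (sub_ne_zero.2 hne))
    have h4 := hκsq x hx
    have h5 := hypos z hz
    have h6 : κ z ^ 2 = 2 * y z := by linarith
    rw [h1, h6] at h4
    nlinarith
  -- Hence every turning point is a global extremum, of a kind decided by comparing `2 y z` with
  -- `1`.
  have hmaxmin : ∀ z ∈ Ici (0 : ℝ), U z = 0 →
      (1 ≤ 2 * y z → ∀ x ∈ Ici (0 : ℝ), y x ≤ y z) ∧
      (2 * y z ≤ 1 → ∀ x ∈ Ici (0 : ℝ), y z ≤ y x) := by
    intro z hz hUz
    constructor <;> intro h1 x hx <;> by_contra! hlt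
    · nlinarith [hratio x hx z hz hUz hlt.ne']
    · nlinarith [hratio x hx z hz hUz hlt.ne]
  have hextr : (∃ z ∈ Ici (0 : ℝ), ∀ x ∈ Ici (0 : ℝ), y x ≤ y z) ∧
      (∃ z ∈ Ici (0 : ℝ), ∀ x ∈ Ici (0 : ℝ), y z ≤ y x) := by
    by_cases hne : ∀ x ∈ Ici (0 : ℝ), U x = 0 → 1 - (C * Real.exp (y x)) ^ 2 ≠ 0
    · obtain ⟨s, hs, z, hz, hUz, hlt⟩ := hosc.exists_turning_above (fun x _ => hy0 x) hyM hne
      obtain ⟨s', hs', z', hz', hUz', hlt'⟩ :=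
        hosc.exists_turning_below (fun x _ => hy0 x) hyM hne
      -- A turning point above another value of `y` is not a global minimum, hence is a global
      -- maximum; symmetrically below.
      refine ⟨⟨z, hz, (hmaxmin z hz hUz).1 ?_⟩, ⟨z', hz', (hmaxmin z' hz' hUz').2 ?_⟩⟩
      · by_contra! h1
        exact absurd ((hmaxmin z hz hUz).2 h1.le s hs) (not_le.2 hlt)
      · by_contra! h1
        exact absurd ((hmaxmin z' hz' hUz').1 h1.le s' hs') (not_le.2 hlt')
    -- At an equilibrium `2 y z = 1`, so `z` is both a maximum and a minimum: `y` is constant and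
    -- the curve runs on a circle.
    · push Not at hne
      obtain ⟨z, hz, hUz, hg⟩ := hne
      have h1 := hUκ z hz
      rw [hκC z hz, hUz] at h1
      exact ⟨⟨z, hz, (hmaxmin z hz hUz).1 (by linarith)⟩,
        ⟨z, hz, (hmaxmin z hz hUz).2 (by linarith)⟩⟩
  have hcκ : ContinuousOn κ (Ici 0) := fun x hx => (h.hasDeriv_kappa hx).continuousWithinAt
  have hcy : ContinuousOn y (Ici 0) := fun x hx => (h.hasDeriv_normSq hx).continuousWithinAt
  -- The integrand is the angular speed `(A B' - B A') / |X|²`.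
  obtain ⟨φ, hφ0, hφ⟩ := exists_antideriv_Ici (h := fun x => V x * κ x / (2 * y x))
    ((h.continuousOn_V.mul hcκ).div (continuousOn_const.mul hcy) fun x hx =>
      (mul_pos two_pos (hypos x hx)).ne')
  have hφmono : StrictMonoOn φ (Ici 0) := fun a ha b _ hab =>
    lt_of_deriv_pos hφ ha hab fun x hx _ => by
      have hx0 : x ∈ Ici (0 : ℝ) := le_trans ha hx.le
      have := hypos x hx0
      have := h.V_pos x hx0
      have := hCpos.trans_le (hCκ x hx0)
      positivity
  have hφunb : ∀ M, ∃ x ∈ Ici (0 : ℝ), M ≤ φ x := by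
    intro M
    -- `κ ≥ C` and `2y ≤ 4 / C²` bound the angular speed per unit length below by `C³ / 4`.
    have hδ : 0 < C ^ 3 / 4 := by positivity
    obtain ⟨x, hx, hM⟩ := h.L_unbounded (L 0 + M / (C ^ 3 / 4))
    refine ⟨x, hx, ?_⟩
    have := le_of_deriv_nonneg (fun x hx => (hφ x hx).sub
      ((h.hasDeriv_L x hx).const_mul (C ^ 3 / 4))) le_rfl hx fun z hz _ => by
        have hz0 : z ∈ Ici (0 : ℝ) := hz.le
        have h1 := hypos z hz0
        have h2 := h.V_pos z hz0
        have h3 := hCκ z hz0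
        have h4 := hyM z hz0
        rw [le_div_iff₀ (by positivity)] at h4
        rw [sub_nonneg, le_div_iff₀ (by positivity)]
        calc C ^ 3 / 4 * V z * (2 * y z) = V z * (C * (y z * C ^ 2) / 2) := by ring
          _ ≤ V z * (C * 2 / 2) := by gcongr
          _ = V z * C := by ring
          _ ≤ V z * κ z := by gcongr
    simp only [Pi.sub_apply, hφ0] at this
    have h2 := mul_le_mul_of_nonneg_left hM hδ.le
    rw [mul_add, mul_div_cancel₀ _ hδ.ne'] at h2
    linarith
  -- the polar coordinates of `X` are `√(2 y)` and `φ`, up to a constant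
  have hsq : ∀ x ∈ Ici (0 : ℝ), HasDerivWithinAt (fun x => √(y x))
      (V x * U x / (2 * √(y x))) (Ici 0) x := fun x hx =>
    (h.hasDeriv_normSq hx).sqrt (hypos x hx).ne'
  have hsqpos : ∀ x ∈ Ici (0 : ℝ), 0 < √(y x) := fun x hx => Real.sqrt_pos.2 (hypos x hx)
  have hsqsq : ∀ x ∈ Ici (0 : ℝ), √(y x) ^ 2 = y x := fun x hx => Real.sq_sqrt (hy0 x)
  have hα : ∀ x ∈ Ici (0 : ℝ), HasDerivWithinAt
      (fun x => (A x * Real.cos (φ x) + B x * Real.sin (φ x)) / √(y x)) 0 (Ici 0) x := by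
    intro x hx
    refine ((((h.hasDeriv_A x hx).mul (hφ x hx).cos).add
      ((h.hasDeriv_B x hx).mul (hφ x hx).sin)).div (hsq x hx) (hsqpos x hx).ne').congr_deriv ?_
    have h1 := hsqpos x hx
    have h2 : A x ^ 2 + B x ^ 2 = 2 * √(y x) ^ 2 := by rw [hsqsq x hx]; simp only [hy]; ring
    rw [div_eq_zero_iff]; left
    rw [← hsqsq x hx, Real.sqrt_sq h1.le]
    generalize √(y x) = S at *
    simp only [hU, hκ, Pi.add_apply, Pi.mul_apply]
    field_simp
    linear_combination (-V x * (P x * Real.cos (φ x) + Q x * Real.sin (φ x))) * h2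
  have hβ : ∀ x ∈ Ici (0 : ℝ), HasDerivWithinAt
      (fun x => (B x * Real.cos (φ x) - A x * Real.sin (φ x)) / √(y x)) 0 (Ici 0) x := by
    intro x hx
    refine ((((h.hasDeriv_B x hx).mul (hφ x hx).cos).sub
      ((h.hasDeriv_A x hx).mul (hφ x hx).sin)).div (hsq x hx) (hsqpos x hx).ne').congr_deriv ?_
    have h1 := hsqpos x hx
    have h2 : A x ^ 2 + B x ^ 2 = 2 * √(y x) ^ 2 := by rw [hsqsq x hx]; simp only [hy]; ring
    rw [div_eq_zero_iff]; left
    rw [← hsqsq x hx, Real.sqrt_sq h1.le]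
    generalize √(y x) = S at *
    simp only [hU, hκ, Pi.sub_apply, Pi.mul_apply]
    field_simp
    linear_combination (-V x * (Q x * Real.cos (φ x) - P x * Real.sin (φ x))) * h2
  obtain ⟨ψ, hψc, hψ⟩ := exists_continuousOn_rightInverse_Ici
    (fun x hx => (hφ x hx).continuousWithinAt) hφmono hφ0 hφunb
  have hφnn : ∀ x ∈ Ici (0 : ℝ), φ x ∈ Ici (0 : ℝ) := fun x hx => by
    have := hφmono.monotoneOn self_mem_Ici hx hx
    rwa [hφ0] at this
  have hψφ : ∀ x ∈ Ici (0 : ℝ), ψ (φ x) = x := fun x hx =>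
    hφmono.injOn (hψ _ (hφnn x hx)).1 hx (hψ _ (hφnn x hx)).2
  have hpi := Real.pi_pos
  have h2π : ∀ a ∈ Ici (0 : ℝ), a + 2 * Real.pi ∈ Ici (0 : ℝ) := fun a ha =>
    add_nonneg (mem_Ici.1 ha) (by positivity)
  have hGc : ContinuousOn (fun a => y (ψ (a + 2 * Real.pi)) - y (ψ a)) (Ici 0) := by
    refine ContinuousOn.sub (hcy.comp (by fun_prop) fun a ha => (hψ _ (h2π a ha)).1)
      (hcy.comp hψc.continuousOn fun a ha => (hψ a ha).1)
  obtain ⟨⟨z, hz, hmax⟩, ⟨z', hz', hmin⟩⟩ := hextr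
  -- Intermediate value theorem between the angle of the maximum and that of the minimum of `y`.
  obtain ⟨a, ha, ha0⟩ : ∃ a ∈ Ici (0 : ℝ), y (ψ (a + 2 * Real.pi)) - y (ψ a) = 0 := by
    refine (convex_Ici (0 : ℝ)).isPreconnected.intermediate_value (hφnn z hz) (hφnn z' hz') hGc
      ⟨?_, ?_⟩
    · simp only [hψφ z hz, sub_nonpos]
      exact hmax _ (hψ _ (h2π _ (hφnn z hz))).1
    · simp only [hψφ z' hz', sub_nonneg]
      exact hmin _ (hψ _ (h2π _ (hφnn z' hz'))).1
  obtain ⟨hb0, hb⟩ := hψ _ (h2π a ha)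
  obtain ⟨hx0, hx⟩ := hψ a ha
  refine ⟨ψ (a + 2 * Real.pi), hb0, ψ a, hx0, fun heq => ?_, ?_⟩
  · rw [heq, hx] at hb; linarith
  -- The two points have equal radius, and angles differing by `2π`; the constants of `hα` and `hβ`
  -- fix `X` up to a rotation by the angle, which is then undone.
  have e1 := (eq_of_deriv_zero hα hb0).trans (eq_of_deriv_zero hα hx0).symm
  have e2 := (eq_of_deriv_zero hβ hb0).trans (eq_of_deriv_zero hβ hx0).symm
  rw [hb, hx, Real.cos_add_two_pi, Real.sin_add_two_pi, sub_eq_zero.1 ha0,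
    div_left_inj' (hsqpos _ hx0).ne'] at e1 e2
  have hcs := Real.sin_sq_add_cos_sq a
  constructor
  · linear_combination Real.cos a * e1 - Real.sin a * e2 -
      (A (ψ (a + 2 * Real.pi)) - A (ψ a)) * hcs
  · linear_combination Real.sin a * e1 + Real.cos a * e2 -
      (B (ψ (a + 2 * Real.pi)) - B (ψ a)) * hcs

theorem self_intersection (h : ShrinkerSystem A B P Q V L) {x₀ : ℝ} (hx₀ : x₀ ∈ Ici (0 : ℝ))
    (hne : A x₀ * Q x₀ - B x₀ * P x₀ ≠ 0) :
    ∃ x ∈ Ici (0 : ℝ), ∃ y ∈ Ici (0 : ℝ), x ≠ y ∧ A x = A y ∧ B x = B y := by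
  rcases hne.lt_or_gt with hneg | hpos
  · simpa using h.reflect.self_intersection_of_pos hx₀ (by linarith)
  · exact h.self_intersection_of_pos hx₀ hpos

end ShrinkerSystem

/-! ### Complete curves with one end point. -/

theorem HasDerivWithinAt.coord {f : ℝ → Plane} {f' : Plane} {s : Set ℝ} {x : ℝ}
    (h : HasDerivWithinAt f f' s x) (i : Fin 2) :
    HasDerivWithinAt (fun y => f y i) (f' i) s x :=
  (EuclideanSpace.proj (𝕜 := ℝ) i).hasFDerivAt.comp_hasDerivWithinAt x h

theorem plane_eq_of_deriv_zero {f : ℝ → Plane}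
    (hf : ∀ x ∈ Ici (0 : ℝ), HasDerivWithinAt f 0 (Ici 0) x) {a : ℝ} (ha : 0 ≤ a) : f a = f 0 :=
  plane_ext (eq_of_deriv_zero (fun x hx => (hf x hx).coord 0) ha)
    (eq_of_deriv_zero (fun x hx => (hf x hx).coord 1) ha)

namespace IsCompleteHalfLine

variable {σ : ℝ → Plane}

/-- `L` is the integral of the speed, and chords are no longer than increments of `L`. A bound on
`L` would therefore bound the variation. -/
theorem exists_length (h : IsCompleteHalfLine σ) : ∃ L : ℝ → ℝ, L 0 = 0 ∧
    (∀ x ∈ Ici (0 : ℝ), HasDerivWithinAt L ‖vel σ (Ici 0) x‖ (Ici 0) x) ∧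
    ∀ M, ∃ x ∈ Ici (0 : ℝ), M ≤ L x := by
  obtain ⟨L, hL0, hL⟩ := exists_antideriv_Ici
    (h.regular.contDiffOn_vel (uniqueDiffOn_Ici 0)).continuousOn.norm
  refine ⟨L, hL0, hL, fun M => ?_⟩
  by_contra! hM
  have hdist : ∀ a b, 0 ≤ a → a ≤ b → ‖σ b - σ a‖ ≤ L b - L a := by
    intro a b ha hab
    have hsub : Icc a b ⊆ Ici 0 := fun x hx => ha.trans hx.1
    have hsub' : ∀ x ∈ Ico a b, Ici x ⊆ Ici 0 := fun x hx => Ici_subset_Ici.2 (ha.trans hx.1)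
    refine image_norm_le_of_norm_deriv_right_le_deriv_boundary' (f := fun x => σ x - σ a)
      (f' := vel σ (Ici 0)) (B := fun x => L x - L a) (B' := fun x => ‖vel σ (Ici 0) x‖)
      ?_ ?_ (by simp) ?_ ?_ (fun _ _ => le_rfl) (right_mem_Icc.2 hab)
    · exact (h.regular.1.continuousOn.mono hsub).sub continuousOn_const
    · exact fun x hx => ((h.regular.hasDerivWithinAt (hsub ⟨hx.1, hx.2.le⟩)).mono
        (hsub' x hx)).sub_const _
    · exact fun x hx => (((hL x (hsub hx)).mono hsub).continuousWithinAt).sub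
        continuousWithinAt_const
    · exact fun x hx => ((hL x (hsub ⟨hx.1, hx.2.le⟩)).mono (hsub' x hx)).sub_const _
  have hle : eVariationOn σ (Ici 0) ≤ ENNReal.ofReal M := by
    refine iSup_le ?_
    rintro ⟨n, u, hu, hu0⟩
    calc ∑ i ∈ Finset.range n, edist (σ (u (i + 1))) (σ (u i))
        ≤ ∑ i ∈ Finset.range n, ENNReal.ofReal (L (u (i + 1)) - L (u i)) := by
          refine Finset.sum_le_sum fun i _ => ?_
          rw [edist_dist, dist_eq_norm]
          exact ENNReal.ofReal_le_ofReal (hdist _ _ (hu0 i) (hu i.le_succ))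
      _ = ENNReal.ofReal (∑ i ∈ Finset.range n, (L (u (i + 1)) - L (u i))) :=
          (ENNReal.ofReal_sum_of_nonneg fun i _ =>
            (norm_nonneg _).trans (hdist _ _ (hu0 i) (hu i.le_succ))).symm
      _ ≤ ENNReal.ofReal M := by
          rw [Finset.sum_range_sub (fun i => L (u i))]
          have := (norm_nonneg _).trans (hdist 0 (u 0) le_rfl (hu0 0))
          exact ENNReal.ofReal_le_ofReal (by linarith [hM (u n) (hu0 n)])
  rw [h.length] at hle
  exact absurd hle (not_le.2 ENNReal.ofReal_lt_top)

/-- Translating by `-c` and scaling by `√lam` reduces to `k = -⟨x | ν⟩`. The value `lam = 0` is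
admitted because the scale of a flow may have zero derivative at some times. -/
theorem curvature_eq_zero (h : IsCompleteHalfLine σ) {lam : ℝ} (hlam : 0 ≤ lam) {c : Plane}
    (heq : ∀ x ∈ Ici (0 : ℝ), curvature σ (Ici 0) x =
      -lam * inner ℝ (σ x - c) (normal σ (Ici 0) x)) :
    ∀ x ∈ Ici (0 : ℝ), curvature σ (Ici 0) x = 0 := by
  rcases hlam.eq_or_lt with rfl | hpos
  · intro x hx
    rw [heq x hx]; simp
  obtain ⟨L, -, hL, hLunb⟩ := h.exists_length
  have hD := uniqueDiffOn_Ici (0 : ℝ)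
  set m := √lam with hm
  have hm0 : 0 < m := Real.sqrt_pos.2 hpos
  have hmm : m ^ 2 = lam := Real.sq_sqrt hlam
  have hτ : ∀ x ∈ Ici (0 : ℝ), ∀ i, vel σ (Ici 0) x i =
      ‖vel σ (Ici 0) x‖ * tangent σ (Ici 0) x i := fun x hx i => by
    conv_lhs => rw [h.regular.vel_eq hx]
    simp
  have hk : ∀ x ∈ Ici (0 : ℝ), curvature σ (Ici 0) x =
      m * (m * (σ x 0 - c 0) * tangent σ (Ici 0) x 1 -
        m * (σ x 1 - c 1) * tangent σ (Ici 0) x 0) := fun x hx => by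
    rw [heq x hx, normal, inner_plane, ← hmm]
    simp; ring
  have hsys : ShrinkerSystem (fun x => m * (σ x 0 - c 0)) (fun x => m * (σ x 1 - c 1))
      (fun x => tangent σ (Ici 0) x 0) (fun x => tangent σ (Ici 0) x 1)
      (fun x => m * ‖vel σ (Ici 0) x‖) (fun x => m * L x) :=
    { hasDeriv_A := fun x hx =>
        ((((h.regular.hasDerivWithinAt hx).coord 0).sub_const (c 0)).const_mul m).congr_deriv (by
          rw [hτ x hx]; ring)
      hasDeriv_B := fun x hx =>
        ((((h.regular.hasDerivWithinAt hx).coord 1).sub_const (c 1)).const_mul m).congr_deriv (by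
          rw [hτ x hx]; ring)
      hasDeriv_P := fun x hx =>
        ((h.regular.hasDerivWithinAt_tangent hD hx).coord 0).congr_deriv (by
          rw [hk x hx, normal, PiLp.smul_apply, rot_apply_zero, smul_eq_mul]; ring)
      hasDeriv_Q := fun x hx =>
        ((h.regular.hasDerivWithinAt_tangent hD hx).coord 1).congr_deriv (by
          rw [hk x hx, normal, PiLp.smul_apply, rot_apply_one, smul_eq_mul]; ring)
      unit := fun x hx => by rw [← norm_sq_plane, h.regular.norm_tangent hx, one_pow]
      continuousOn_V := continuousOn_const.mul (h.regular.contDiffOn_vel hD).continuousOn.norm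
      V_pos := fun x hx => mul_pos hm0 (h.regular.norm_vel_pos hx)
      hasDeriv_L := fun x hx => (hL x hx).const_mul m
      L_unbounded := fun M => by
        obtain ⟨x, hx, hM⟩ := hLunb (M / m)
        exact ⟨x, hx, (div_le_iff₀' hm0).1 hM⟩ }
  intro x hx
  by_contra hne
  obtain ⟨a, ha, b, hb, hab, h0, h1⟩ := hsys.self_intersection hx fun h0 => hne (by
    rw [hk x hx, h0, mul_zero])
  refine hab (h.injective ha hb (plane_ext ?_ ?_))
  · simpa using mul_left_cancel₀ hm0.ne' h0
  · simpa using mul_left_cancel₀ hm0.ne' h1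

/-- By the Frenet formula the tangent is constant, so the position is affine in the length `L`,
which takes all values in `[0, ∞)`. -/
theorem image_eq_ray (h : IsCompleteHalfLine σ)
    (hk : ∀ x ∈ Ici (0 : ℝ), curvature σ (Ici 0) x = 0) :
    σ '' Ici 0 = ray (σ 0) (tangent σ (Ici 0) 0) := by
  obtain ⟨L, hL0, hL, hLunb⟩ := h.exists_length
  have hτ : ∀ x ∈ Ici (0 : ℝ), tangent σ (Ici 0) x = tangent σ (Ici 0) 0 := fun x hx =>
    plane_eq_of_deriv_zero (fun y hy =>
      (h.regular.hasDerivWithinAt_tangent (uniqueDiffOn_Ici 0) hy).congr_deriv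
        (by rw [hk y hy]; simp)) hx
  have hσ : ∀ x ∈ Ici (0 : ℝ), σ x = σ 0 + L x • tangent σ (Ici 0) 0 := fun x hx => by
    have := plane_eq_of_deriv_zero (f := fun y => σ y - L y • tangent σ (Ici 0) 0) (fun y hy =>
      ((h.regular.hasDerivWithinAt hy).sub ((hL y hy).smul_const _)).congr_deriv (by
        rw [← hτ y hy, ← h.regular.vel_eq hy, sub_self])) hx
    rw [hL0, zero_smul, sub_zero] at this
    rw [← this, sub_add_cancel]
  ext p
  constructor
  · rintro ⟨x, hx, rfl⟩
    refine ⟨L x, ?_, (hσ x hx).symm⟩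
    have := le_of_deriv_nonneg hL le_rfl hx fun z hz _ => norm_nonneg _
    rwa [hL0] at this
  · rintro ⟨s, hs, rfl⟩
    obtain ⟨b, hb, hsb⟩ := hLunb s
    obtain ⟨x, hx, rfl⟩ := intermediate_value_Icc (show (0 : ℝ) ≤ b from hb)
      (fun z hz => ((hL z hz.1).continuousWithinAt).mono fun w hw => hw.1) ⟨hL0.symm ▸ hs, hsb⟩
    exact ⟨x, hx.1, hσ x hx.1⟩

theorem exists_eq_add_smul_tangent (h : IsCompleteHalfLine σ) {lam : ℝ} (hlam : 0 < lam)
    {c : Plane} (heq : ∀ x ∈ Ici (0 : ℝ), curvature σ (Ici 0) x =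
      -lam * inner ℝ (σ x - c) (normal σ (Ici 0) x)) :
    ∃ a : ℝ, σ 0 = c + a • tangent σ (Ici 0) 0 := by
  have h0 := heq 0 self_mem_Ici
  rw [h.curvature_eq_zero hlam.le heq 0 self_mem_Ici] at h0
  have h1 : inner ℝ (σ 0 - c) (rot (tangent σ (Ici 0) 0)) = 0 :=
    (mul_eq_zero.1 h0.symm).resolve_left (neg_ne_zero.2 hlam.ne')
  exact ⟨_, eq_add_of_sub_eq'
    (eq_smul_of_inner_rot_eq_zero (h.regular.norm_tangent self_mem_Ici) h1)⟩

end IsCompleteHalfLine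

/-! ### Complete curves without end points, as two half-infinite curves. -/

namespace IsCompleteLine

variable {σ : ℝ → Plane}

theorem hasDerivAt (h : IsCompleteLine σ) (x : ℝ) : HasDerivAt σ (vel σ univ x) x :=
  hasDerivWithinAt_univ.1 (h.regular.hasDerivWithinAt (mem_univ x))

theorem hasDerivAt_vel (h : IsCompleteLine σ) (x : ℝ) :
    HasDerivAt (vel σ univ) (acc σ univ x) x :=
  hasDerivWithinAt_univ.1 (h.regular.hasDerivWithinAt_vel uniqueDiffOn_univ (mem_univ x))

theorem vel_Ici (h : IsCompleteLine σ) {x : ℝ} (hx : x ∈ Ici (0 : ℝ)) :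
    vel σ (Ici 0) x = vel σ univ x :=
  (h.hasDerivAt x).hasDerivWithinAt.derivWithin (uniqueDiffOn_Ici 0 x hx)

theorem curvature_Ici (h : IsCompleteLine σ) {x : ℝ} (hx : x ∈ Ici (0 : ℝ)) :
    curvature σ (Ici 0) x = curvature σ univ x := by
  have hacc : acc σ (Ici 0) x = acc σ univ x :=
    ((h.hasDerivAt_vel x).hasDerivWithinAt.congr (fun y hy => h.vel_Ici hy)
      (h.vel_Ici hx)).derivWithin (uniqueDiffOn_Ici 0 x hx)
  rw [curvature, curvature, normal, normal, tangent, tangent, hacc, h.vel_Ici hx]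

theorem normal_Ici (h : IsCompleteLine σ) {x : ℝ} (hx : x ∈ Ici (0 : ℝ)) :
    normal σ (Ici 0) x = normal σ univ x := by
  rw [normal, normal, tangent, tangent, h.vel_Ici hx]

theorem isCompleteHalfLine (h : IsCompleteLine σ) : IsCompleteHalfLine σ where
  regular := ⟨h.regular.1.mono (subset_univ _), fun x hx => by
    rw [h.vel_Ici hx]; exact h.regular.2 x (mem_univ x)⟩
  injective := h.injective.injOn
  length := h.length_right

theorem vel_comp_neg (h : IsCompleteLine σ) (x : ℝ) :
    vel (fun y => σ (-y)) univ x = -vel σ univ (-x) := by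
  have := (h.hasDerivAt (-x)).scomp x (hasDerivAt_neg x)
  rw [neg_one_smul] at this
  exact this.hasDerivWithinAt.derivWithin uniqueDiffWithinAt_univ

theorem comp_neg (h : IsCompleteLine σ) : IsCompleteLine fun y => σ (-y) where
  regular := ⟨h.regular.1.comp contDiff_neg.contDiffOn fun _ _ => mem_univ _, fun x _ => by
    rw [h.vel_comp_neg x]; exact neg_ne_zero.2 (h.regular.2 _ (mem_univ _))⟩
  injective := h.injective.comp neg_injective
  length_right := by
    have := eVariationOn.comp_eq_of_antitoneOn σ (t := Ici 0) (fun x : ℝ => -x)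
      fun a _ b _ hab => neg_le_neg hab
    rw [image_neg_Ici, neg_zero, h.length_left] at this
    exact this
  length_left := by
    have := eVariationOn.comp_eq_of_antitoneOn σ (t := Iic 0) (fun x : ℝ => -x)
      fun a _ b _ hab => neg_le_neg hab
    rw [image_neg_Iic, neg_zero, h.length_right] at this
    exact this

theorem tangent_comp_neg (h : IsCompleteLine σ) (x : ℝ) :
    tangent (fun y => σ (-y)) univ x = -tangent σ univ (-x) := by
  rw [tangent, tangent, h.vel_comp_neg, norm_neg, smul_neg]

theorem normal_comp_neg (h : IsCompleteLine σ) (x : ℝ) :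
    normal (fun y => σ (-y)) univ x = -normal σ univ (-x) := by
  rw [normal, normal, h.tangent_comp_neg]
  apply plane_ext <;> simp

theorem curvature_comp_neg (h : IsCompleteLine σ) (x : ℝ) :
    curvature (fun y => σ (-y)) univ x = -curvature σ univ (-x) := by
  have hacc : acc (fun y => σ (-y)) univ x = acc σ univ (-x) := by
    have h1 := ((h.hasDerivAt_vel (-x)).scomp x (hasDerivAt_neg x)).neg
    rw [neg_one_smul, neg_neg] at h1
    have h2 : vel (fun y => σ (-y)) univ = -(vel σ univ ∘ fun y => -y) :=
      funext fun y => h.vel_comp_neg y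
    rw [acc, h2]
    exact h1.hasDerivWithinAt.derivWithin uniqueDiffWithinAt_univ
  rw [curvature, curvature, hacc, h.normal_comp_neg, h.vel_comp_neg, norm_neg, inner_neg_right,
    neg_div]

theorem curvature_eq_zero (h : IsCompleteLine σ) {lam : ℝ} (hlam : 0 ≤ lam) {c : Plane}
    (heq : ∀ x, curvature σ univ x = -lam * inner ℝ (σ x - c) (normal σ univ x)) (x : ℝ) :
    curvature σ univ x = 0 := by
  rcases le_total 0 x with hx | hx
  · rw [← h.curvature_Ici hx]
    refine h.isCompleteHalfLine.curvature_eq_zero hlam (c := c) (fun y hy => ?_) x hx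
    rw [h.curvature_Ici hy, heq, h.normal_Ici hy]
  -- Reversing the orientation changes the sign of both `k` and `ν`, so the equation persists.
  · have h1 := h.comp_neg.isCompleteHalfLine.curvature_eq_zero hlam (c := c) (fun y hy => by
      rw [h.comp_neg.curvature_Ici hy, h.comp_neg.normal_Ici hy, h.curvature_comp_neg,
        h.normal_comp_neg, heq, inner_neg_right, mul_neg]) (-x) (neg_nonneg.2 hx)
    rw [h.comp_neg.curvature_Ici (neg_nonneg.2 hx), h.curvature_comp_neg, neg_neg] at h1
    exact neg_eq_zero.1 h1

theorem exists_eq_add_smul_tangent (h : IsCompleteLine σ) {lam : ℝ} (hlam : 0 < lam) {c : Plane}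
    (heq : ∀ x, curvature σ univ x = -lam * inner ℝ (σ x - c) (normal σ univ x)) :
    ∃ a : ℝ, σ 0 = c + a • tangent σ univ 0 := by
  have := h.isCompleteHalfLine.exists_eq_add_smul_tangent hlam (c := c) fun x hx => by
    rw [h.curvature_Ici hx, heq, h.normal_Ici hx]
  rwa [tangent, h.vel_Ici self_mem_Ici, ← tangent] at this

theorem range_eq_straightLine (h : IsCompleteLine σ) (hk : ∀ x, curvature σ univ x = 0) :
    range σ = straightLine (σ 0) (tangent σ univ 0) := by
  have e1 := h.isCompleteHalfLine.image_eq_ray fun x hx => by rw [h.curvature_Ici hx, hk]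
  have e2 := h.comp_neg.isCompleteHalfLine.image_eq_ray fun x hx => by
    rw [h.comp_neg.curvature_Ici hx, h.curvature_comp_neg, hk, neg_zero]
  rw [tangent, h.vel_Ici self_mem_Ici, ← tangent] at e1
  rw [tangent, h.comp_neg.vel_Ici self_mem_Ici, ← tangent, h.tangent_comp_neg] at e2
  simp only [neg_zero] at e2
  ext p
  constructor
  · rintro ⟨x, rfl⟩
    rcases le_total 0 x with hx | hx
    · have : σ x ∈ ray (σ 0) (tangent σ univ 0) := e1 ▸ mem_image_of_mem σ hx
      obtain ⟨s, -, hs⟩ := this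
      exact ⟨s, hs⟩
    · have : σ x ∈ ray (σ 0) (-tangent σ univ 0) := e2 ▸ ⟨-x, neg_nonneg.2 hx, by simp⟩
      obtain ⟨s, -, hs⟩ := this
      exact ⟨-s, by rw [← hs]; simp⟩
  · rintro ⟨s, rfl⟩
    rcases le_total 0 s with hs | hs
    · have : σ 0 + s • tangent σ univ 0 ∈ σ '' Ici 0 := e1 ▸ ⟨s, hs, rfl⟩
      exact image_subset_range _ _ this
    · have : σ 0 + s • tangent σ univ 0 ∈ (fun y => σ (-y)) '' Ici 0 :=
        e2 ▸ ⟨-s, neg_nonneg.2 hs, by simp⟩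
      obtain ⟨x, -, hx⟩ := this
      exact ⟨-x, hx⟩

end IsCompleteLine

/-! ### Second-order contact of curves. -/

section Osculation

open Filter Topology Asymptotics

theorem HasDerivWithinAt.isBigO_sub_symm {f : ℝ → Plane} {f' : Plane} {s : Set ℝ} {x₀ : ℝ}
    (h : HasDerivWithinAt f f' s x₀) (hf' : f' ≠ 0) :
    (fun x => x - x₀) =O[𝓝[s] x₀] fun x => f x - f x₀ :=
  (HasDerivAtFilter.isTheta_sub h hf').isBigO_symm.comp_tendsto
    (k := fun x => (x, x₀)) (tendsto_id.prodMk (tendsto_pure.2 (Eventually.of_forall fun _ => rfl)))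

/-- Mean value inequality: near `x₀`, `|g| ≤ ε |x - x₀|` on the segment from `x₀` to `x`, so `|f| ≤
ε |x - x₀|²`. Differentiability of `g` at `x₀` alone suffices. -/
theorem isLittleO_sq_of_deriv {D : Set ℝ} (hD : Convex ℝ D) {f g : ℝ → ℝ} {x₀ : ℝ} (hx₀ : x₀ ∈ D)
    (hf : ∀ x ∈ D, HasDerivWithinAt f (g x) D x) (hg : HasDerivWithinAt g 0 D x₀)
    (hg0 : g x₀ = 0) (hf0 : f x₀ = 0) : f =o[𝓝[D] x₀] fun x => (x - x₀) ^ 2 := by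
  rw [isLittleO_iff]
  intro ε hε
  have h1 := isLittleO_iff.1 hg.isLittleO hε
  simp only [hg0, smul_zero, sub_zero] at h1
  obtain ⟨δ, hδ, hsub⟩ := Metric.mem_nhdsWithin_iff.1 h1
  filter_upwards [inter_mem_nhdsWithin D (Metric.ball_mem_nhds x₀ hδ)] with x hx
  have hseg : segment ℝ x₀ x ⊆ D := hD.segment_subset hx₀ hx.1
  have hball : segment ℝ x₀ x ⊆ Metric.ball x₀ δ :=
    (convex_ball x₀ δ).segment_subset (Metric.mem_ball_self hδ) hx.2
  have h2 := Convex.norm_image_sub_le_of_norm_hasDerivWithin_le (C := ε * ‖x - x₀‖)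
    (fun z hz => (hf z (hseg hz)).mono hseg) (fun z hz => ?_) (convex_segment x₀ x)
    (left_mem_segment ℝ x₀ x) (right_mem_segment ℝ x₀ x)
  · rw [hf0, sub_zero] at h2
    rw [norm_pow, sq, ← mul_assoc]
    exact h2
  · refine (hsub ⟨hball hz, hseg hz⟩).trans (mul_le_mul_of_nonneg_left ?_ hε.le)
    rw [segment_eq_uIcc] at hz
    rw [Real.norm_eq_abs, Real.norm_eq_abs]
    exact abs_sub_left_of_mem_uIcc hz

/-- Vanishes to second order at the points of a curve with normal `n` and curvature `k` at `p`. -/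
noncomputable def osculation (p n : Plane) (k : ℝ) (q : Plane) : ℝ :=
  inner ℝ (q - p) n - k / 2 * ‖q - p‖ ^ 2

variable {σ : ℝ → Plane} {D : Set ℝ} {x₀ : ℝ}

theorem IsRegularCurve.hasDerivWithinAt_osculation (h : IsRegularCurve σ D) (p n : Plane) (k : ℝ)
    {x : ℝ} (hx : x ∈ D) : HasDerivWithinAt (fun x => osculation p n k (σ x))
      (inner ℝ (vel σ D x) n - k * inner ℝ (σ x - p) (vel σ D x)) D x := by
  have h1 := (h.hasDerivWithinAt hx).sub_const p
  exact ((h1.inner ℝ (hasDerivWithinAt_const x D n)).sub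
    (h1.norm_sq.const_mul (k / 2))).congr_deriv (by simp; ring)

theorem IsRegularCurve.hasDerivWithinAt_osculation_deriv (h : IsRegularCurve σ D)
    (hD : UniqueDiffOn ℝ D) (hx₀ : x₀ ∈ D) (n : Plane) (k : ℝ) :
    HasDerivWithinAt (fun x => inner ℝ (vel σ D x) n - k * inner ℝ (σ x - σ x₀) (vel σ D x))
      (inner ℝ (acc σ D x₀) n - k * ‖vel σ D x₀‖ ^ 2) D x₀ := by
  have h1 := (h.hasDerivWithinAt hx₀).sub_const (σ x₀)
  have h2 := h.hasDerivWithinAt_vel hD hx₀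
  exact ((h2.inner ℝ (hasDerivWithinAt_const x₀ D n)).sub
    ((h1.inner ℝ h2).const_mul k)).congr_deriv (by simp)

/-- An injective continuous map on a compact set is an embedding: points of the arc close to `σ x₀`
come from parameters close to `x₀`. This turns estimates in the parameter into estimates on the arc
as a set. -/
theorem nhdsWithin_image_le_map {K : Set ℝ} (hK : IsCompact K) (hc : ContinuousOn σ K)
    (hinj : InjOn σ K) (hx₀ : x₀ ∈ K) : 𝓝[σ '' K] (σ x₀) ≤ map σ (𝓝[K] x₀) := by
  have := isCompact_iff_compactSpace.1 hK
  have hemb := (continuousOn_iff_continuous_domRestrict.1 hc).isClosedEmbedding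
    (injOn_iff_injective.1 hinj)
  have := hemb.isEmbedding.map_nhds_eq ⟨x₀, hx₀⟩
  rw [range_domRestrict] at this
  rw [nhdsWithin_eq_map_subtype_coe hx₀, map_map]
  exact this.ge

theorem IsRegularCurve.osculation_isLittleO (h : IsRegularCurve σ D) (hD : UniqueDiffOn ℝ D)
    (hconv : Convex ℝ D) (hcomp : IsCompact D) (hinj : InjOn σ D) (hx₀ : x₀ ∈ D) :
    osculation (σ x₀) (normal σ D x₀) (curvature σ D x₀) =o[𝓝[σ '' D] (σ x₀)]
      fun q => ‖q - σ x₀‖ ^ 2 := by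
  refine IsLittleO.mono ?_ (nhdsWithin_image_le_map hcomp h.1.continuousOn hinj hx₀)
  rw [isLittleO_map]
  have h1 := isLittleO_sq_of_deriv hconv hx₀
    (fun x hx => h.hasDerivWithinAt_osculation (σ x₀) (normal σ D x₀) (curvature σ D x₀) hx)
    ((h.hasDerivWithinAt_osculation_deriv hD hx₀ _ _).congr_deriv
      (by rw [h.inner_acc_normal hx₀, sub_self]))
    (by simp [inner_vel_normal]) (by simp [osculation])
  exact h1.trans_isBigO (((h.hasDerivWithinAt hx₀).isBigO_sub_symm (h.2 x₀ hx₀)).norm_right.pow 2)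

theorem IsRegularCurve.inner_normal_isLittleO (h : IsRegularCurve σ D) (hD : UniqueDiffOn ℝ D)
    (hconv : Convex ℝ D) (hcomp : IsCompact D) (hinj : InjOn σ D) (hx₀ : x₀ ∈ D) :
    (fun q => inner ℝ (q - σ x₀) (normal σ D x₀)) =o[𝓝[σ '' D] (σ x₀)] fun q => q - σ x₀ := by
  have hsq : (fun q => ‖q - σ x₀‖ ^ 2) =o[𝓝[σ '' D] (σ x₀)] fun q => q - σ x₀ := by
    have h0 : Tendsto (fun q => q - σ x₀) (𝓝[σ '' D] (σ x₀)) (𝓝 0) := by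
      have : ContinuousWithinAt (fun q => q - σ x₀) (σ '' D) (σ x₀) := by fun_prop
      simpa [ContinuousWithinAt] using this
    exact (isLittleO_norm_pow_id one_lt_two).comp_tendsto h0
  have h1 := ((h.osculation_isLittleO hD hconv hcomp hinj hx₀).trans hsq).add
    (hsq.const_mul_left (curvature σ D x₀ / 2))
  refine h1.congr_left fun q => ?_
  simp [osculation]

/-- A regular curve running inside an embedded arc near a common point has the tangent and the
curvature of the arc there. -/
theorem IsRegularCurve.contact (h : IsRegularCurve σ D) (hD : UniqueDiffOn ℝ D)
    (hconv : Convex ℝ D) {p n : Plane} {k : ℝ} {S : Set Plane} (hx₀ : x₀ ∈ D) (hp : σ x₀ = p)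
    (hS : ∀ᶠ x in 𝓝[D] x₀, σ x ∈ S)
    (h1 : (fun q => inner ℝ (q - p) n) =o[𝓝[S] p] fun q => q - p)
    (h2 : osculation p n k =o[𝓝[S] p] fun q => ‖q - p‖ ^ 2) :
    inner ℝ (vel σ D x₀) n = 0 ∧ inner ℝ (acc σ D x₀) n = k * ‖vel σ D x₀‖ ^ 2 := by
  subst hp
  have hder := h.hasDerivWithinAt hx₀
  have htend : Tendsto σ (𝓝[D] x₀) (𝓝[S] (σ x₀)) :=
    tendsto_nhdsWithin_iff.2 ⟨hder.continuousWithinAt, hS⟩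
  have hO : (fun x => σ x - σ x₀) =O[𝓝[D] x₀] fun x => x - x₀ := hder.hasFDerivWithinAt.isBigO_sub
  have e1 : inner ℝ (vel σ D x₀) n = 0 := by
    have h3 := (h1.comp_tendsto htend).trans_isBigO hO
    have h4 : HasDerivWithinAt (fun x => inner ℝ (σ x - σ x₀) n) 0 D x₀ :=
      HasDerivWithinAt.of_isLittleO (by simpa [Function.comp_def] using h3)
    have h5 : HasDerivWithinAt (fun x => inner ℝ (σ x - σ x₀) n) (inner ℝ (vel σ D x₀) n) D x₀ :=
      ((hder.sub_const (σ x₀)).inner ℝ (hasDerivWithinAt_const x₀ D n)).congr_deriv (by simp)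
    exact (hD x₀ hx₀).eq_deriv _ h5 h4
  refine ⟨e1, sub_eq_zero.1 ?_⟩
  -- `m` is the second derivative of the osculation along `σ` at `x₀`; its Taylor term `m / 2 * (x -
  -- x₀) ^ 2` must be negligible against `(x - x₀) ^ 2`, so `m = 0`.
  set m := inner ℝ (acc σ D x₀) n - k * ‖vel σ D x₀‖ ^ 2 with hm
  have h3 : (fun x => osculation (σ x₀) n k (σ x)) =o[𝓝[D] x₀] fun x => (x - x₀) ^ 2 :=
    (h2.comp_tendsto htend).trans_isBigO (hO.norm_left.pow 2)
  have h4 := isLittleO_sq_of_deriv hconv hx₀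
    (f := fun x => osculation (σ x₀) n k (σ x) - m / 2 * (x - x₀) ^ 2)
    (g := fun x => inner ℝ (vel σ D x) n - k * inner ℝ (σ x - σ x₀) (vel σ D x) - m * (x - x₀))
    (fun x hx => ((h.hasDerivWithinAt_osculation (σ x₀) n k hx).sub
      ((((hasDerivWithinAt_id x D).sub_const x₀).pow 2).const_mul (m / 2))).congr_deriv
        (by simp; ring))
    (((h.hasDerivWithinAt_osculation_deriv hD hx₀ n k).sub
      (((hasDerivWithinAt_id x₀ D).sub_const x₀).const_mul m)).congr_deriv (by simp [hm]))
    (by simp [e1]) (by simp [osculation])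
  have h5 : (fun x => m / 2 * (x - x₀) ^ 2) =o[𝓝[D] x₀] fun x => (x - x₀) ^ 2 :=
    (h3.sub h4).congr_left fun x => by simp
  by_contra hne
  have h6 : (fun x : ℝ => (x - x₀) ^ 2) =o[𝓝[D] x₀] fun x => (x - x₀) ^ 2 :=
    (isLittleO_const_mul_left_iff (div_ne_zero hne two_ne_zero)).1 h5
  have h7 := isLittleO_irrefl' (l := 𝓝[D \ {x₀}] x₀) (f' := fun x : ℝ => (x - x₀) ^ 2) ?_
  · exact h7 (h6.mono (nhdsWithin_mono _ sdiff_subset))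
  · have : (𝓝[D \ {x₀}] x₀).NeBot := 
      accPt_principal_iff_nhdsWithin.1 (hD x₀ hx₀).accPt
    refine Eventually.frequently ?_
    filter_upwards [self_mem_nhdsWithin] with x hx
    exact norm_ne_zero_iff.2 (pow_ne_zero 2 (sub_ne_zero.2 hx.2))

end Osculation

/-! ### The equation of a homothetically shrinking flow. -/

section Flow

open Filter Topology Asymptotics

theorem uniqueDiffOn_of_ordConnected {I : Set ℝ} (hI : I.OrdConnected) (hnt : I.Nontrivial) :
    UniqueDiffOn ℝ I := by
  obtain ⟨a, ha, b, hb, hab⟩ := hnt.exists_lt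
  refine uniqueDiffOn_convex hI.convex ⟨(a + b) / 2, mem_interior.2 ⟨Ioo a b,
    Ioo_subset_Icc_self.trans (hI.out ha hb), isOpen_Ioo, ?_, ?_⟩⟩ <;> linarith

/-- A flow by curvature shrinking homothetically around `c` with the scale `r` satisfies
`k = (r' / r) ⟨x - c | ν⟩`. -/
theorem IsCurveFlowNear.curvature_eq {T : ℝ → Set Plane} {I : Set ℝ} {t₀ : ℝ} {p c : Plane}
    {r : ℝ → ℝ} {r' : ℝ} (hT : IsCurveFlowNear T I t₀ p) (hI : UniqueDiffOn ℝ I) (ht₀ : t₀ ∈ I)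
    (hr : 0 < r t₀) (hr' : HasDerivWithinAt r r' I t₀)
    (hhom : ∀ s ∈ I, T t₀ = AffineMap.homothety c (r t₀ / r s) '' T s)
    {σ : ℝ → Plane} {D : Set ℝ} {x₀ : ℝ} (h : IsRegularCurve σ D) (hD : UniqueDiffOn ℝ D)
    (hconv : Convex ℝ D) (hsub : ∀ x ∈ D, σ x ∈ T t₀) (hx₀ : x₀ ∈ D) (hp : σ x₀ = p) :
    curvature σ D x₀ = r' / r t₀ * inner ℝ (p - c) (normal σ D x₀) := by
  obtain ⟨U, ε, γ, hU, hpU, hε, ⟨y, hy, hyp⟩, hslice, hmove⟩ := hT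
  have hyK : y ∈ Icc (-1 : ℝ) 1 := Ioo_subset_Icc_self hy
  have hJ : Ioo (t₀ - ε) (t₀ + ε) ∈ 𝓝 t₀ := Ioo_mem_nhds (by linarith) (by linarith)
  have ht₀J : t₀ ∈ timesNear I t₀ ε := ⟨ht₀, mem_of_mem_nhds hJ⟩
  obtain ⟨hreg, hinj, hin, -⟩ := hslice t₀ ht₀J
  obtain ⟨w, hw, hwk⟩ := hmove t₀ ht₀J y hyK
  have hK : UniqueDiffOn ℝ (Icc (-1 : ℝ) 1) := uniqueDiffOn_Icc (by norm_num)
  set n := normal (fun z => γ z t₀) (Icc (-1) 1) y with hn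
  set k := curvature (fun z => γ z t₀) (Icc (-1) 1) y with hk
  set S := (fun z => γ z t₀) '' Icc (-1) 1 with hS
  have hn1 : ‖n‖ = 1 := hreg.norm_normal hyK
  have o1 := hreg.inner_normal_isLittleO hK (convex_Icc _ _) isCompact_Icc hinj hyK
  have o2 := hreg.osculation_isLittleO hK (convex_Icc _ _) isCompact_Icc hinj hyK
  have hyp' : γ y t₀ = p := hyp
  simp only [hyp', ← hn, ← hk, ← hS] at o1 o2
  -- the curve `σ` touches the arc to second order
  obtain ⟨c1, c2⟩ := h.contact hD hconv hx₀ hp (S := S) (by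
    have hcont := (h.1.continuousOn x₀ hx₀).eventually (hU.mem_nhds (hp.symm ▸ hpU))
    filter_upwards [hcont, self_mem_nhdsWithin] with x hxU hxD
    exact hin ⟨hsub x hxD, hxU⟩) o1 o2
  -- the rescaled trajectory of `p` stays in the arc
  have hρ : HasDerivWithinAt (fun s => r t₀ / r s) (-(r' / r t₀)) (timesNear I t₀ ε) t₀ :=
    ((hasDerivWithinAt_const t₀ _ (r t₀)).div (hr'.mono inter_subset_left) hr.ne').congr_deriv
      (by field_simp; ring)
  have hη : HasDerivWithinAt (fun s => AffineMap.homothety c (r t₀ / r s) (γ y s))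
      (w - (r' / r t₀) • (p - c)) (timesNear I t₀ ε) t₀ := by
    have := (hρ.smul (hw.sub_const c)).add_const c
    refine (this.congr_deriv ?_)
    rw [div_self hr.ne', hyp']
    module
  have hη0 : AffineMap.homothety c (r t₀ / r t₀) (γ y t₀) = p := by
    rw [div_self hr.ne', AffineMap.homothety_one, hyp']; rfl
  have hηS : ∀ᶠ s in 𝓝[timesNear I t₀ ε] t₀,
      AffineMap.homothety c (r t₀ / r s) (γ y s) ∈ S := by
    have hcont := hη.continuousWithinAt.eventually (hU.mem_nhds
      (show AffineMap.homothety c (r t₀ / r t₀) (γ y t₀) ∈ U by rw [hη0]; exact hpU))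
    filter_upwards [hcont, self_mem_nhdsWithin] with s hsU hs
    refine hin ⟨?_, hsU⟩
    rw [hhom s hs.1]
    exact mem_image_of_mem _ ((hslice s hs).2.2.2 (mem_image_of_mem _ hyK))
  -- A trajectory inside the arc has tangential velocity. With `⟨w | n⟩ = k` this is the equation
  -- for the arc.
  have hw0 : inner ℝ (w - (r' / r t₀) • (p - c)) n = 0 := by
    have htend : Tendsto (fun s => AffineMap.homothety c (r t₀ / r s) (γ y s))
        (𝓝[timesNear I t₀ ε] t₀) (𝓝[S] p) :=
      tendsto_nhdsWithin_iff.2 ⟨by simpa only [hη0] using hη.continuousWithinAt.tendsto, hηS⟩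
    have hO := hη.hasFDerivWithinAt.isBigO_sub
    rw [hη0] at hO
    have h4 : HasDerivWithinAt
        (fun s => inner ℝ (AffineMap.homothety c (r t₀ / r s) (γ y s) - p) n) 0
        (timesNear I t₀ ε) t₀ :=
      HasDerivWithinAt.of_isLittleO (by
        simpa only [hη0, sub_self, inner_zero_left, smul_zero, sub_zero, Function.comp_def] using
          (o1.comp_tendsto htend).trans_isBigO hO)
    have h5 : HasDerivWithinAt
        (fun s => inner ℝ (AffineMap.homothety c (r t₀ / r s) (γ y s) - p) n)
        (inner ℝ (w - (r' / r t₀) • (p - c)) n) (timesNear I t₀ ε) t₀ :=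
      ((hη.sub_const p).inner ℝ (hasDerivWithinAt_const t₀ _ n)).congr_deriv (by simp)
    exact ((hI t₀ ht₀).inter hJ).eq_deriv _ h5 h4
  rw [inner_sub_left, inner_smul_left, hwk, sub_eq_zero] at hw0
  simp only [conj_trivial] at hw0
  -- the normals of `σ` and of the arc agree up to the sign
  have hτn : inner ℝ (tangent σ D x₀) n = 0 := by
    rw [tangent, inner_smul_left, c1, mul_zero]
  have hne : n = (inner ℝ n (normal σ D x₀) : ℝ) • normal σ D x₀ :=
    eq_smul_rot_of_inner_eq_zero (h.norm_tangent hx₀) hτn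
  set e : ℝ := inner ℝ n (normal σ D x₀) with he
  have he0 : e ≠ 0 := fun h0 => by
    rw [h0, zero_smul] at hne
    rw [hne, norm_zero] at hn1
    exact zero_ne_one hn1
  rw [hne, inner_smul_right, h.inner_acc_normal hx₀, hw0, hne, inner_smul_right] at c2
  refine mul_left_cancel₀ (mul_ne_zero he0 (pow_ne_zero 2 (h.norm_vel_pos hx₀).ne')) ?_
  linear_combination c2

/-- Strict monotonicity allows `r'` to vanish at some times, but not throughout the interval. -/
theorem exists_derivWithin_ne_zero {I : Set ℝ} {r : ℝ → ℝ} (hI : I.OrdConnected)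
    (hnt : I.Nontrivial) (hd : DifferentiableOn ℝ r I) (ha : StrictAntiOn r I) :
    ∃ t ∈ I, derivWithin r I t ≠ 0 := by
  by_contra! h0
  obtain ⟨a, haI, b, hbI, hab⟩ := hnt.exists_lt
  have := Convex.norm_image_sub_le_of_norm_hasDerivWithin_le (C := 0)
    (fun x hx => (hd x hx).hasDerivWithinAt) (fun x hx => by simp [h0 x hx]) hI.convex haI hbI
  rw [zero_mul, norm_le_zero_iff, sub_eq_zero] at this
  exact (ha haI hbI hab).ne this

end Flow

/-! ### Half-lines and lines under homotheties. -/

section Rays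

variable {c v : Plane} {ρ : ℝ}

theorem homothety_image_ray (hρ : 0 < ρ) (a : ℝ) :
    AffineMap.homothety c ρ '' ray (c + a • v) v = ray (c + (ρ * a) • v) v := by
  ext q
  constructor
  · rintro ⟨_, ⟨s, hs, rfl⟩, rfl⟩
    refine ⟨ρ * s, mul_nonneg hρ.le hs, ?_⟩
    simp only [AffineMap.homothety_apply, vsub_eq_sub, vadd_eq_add]
    module
  · rintro ⟨s, hs, rfl⟩
    refine ⟨_, ⟨s / ρ, div_nonneg hs hρ.le, rfl⟩, ?_⟩
    simp only [AffineMap.homothety_apply, vsub_eq_sub, vadd_eq_add]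
    match_scalars <;> field_simp
    ring

theorem homothety_image_ray_self (hρ : 0 < ρ) :
    AffineMap.homothety c ρ '' ray c v = ray c v := by
  simpa using homothety_image_ray (v := v) (c := c) hρ 0

theorem homothety_image_straightLine (hρ : 0 < ρ) :
    AffineMap.homothety c ρ '' straightLine c v = straightLine c v := by
  ext q
  constructor
  · rintro ⟨_, ⟨s, rfl⟩, rfl⟩
    refine ⟨ρ * s, ?_⟩
    simp only [AffineMap.homothety_apply, vsub_eq_sub, vadd_eq_add]
    module
  · rintro ⟨s, rfl⟩
    refine ⟨_, ⟨s / ρ, rfl⟩, ?_⟩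
    simp only [AffineMap.homothety_apply, vsub_eq_sub, vadd_eq_add]
    match_scalars <;> field_simp
    ring

theorem straightLine_add_smul (c v : Plane) (a : ℝ) :
    straightLine (c + a • v) v = straightLine c v := by
  ext q
  constructor
  · rintro ⟨s, rfl⟩
    exact ⟨a + s, by module⟩
  · rintro ⟨s, rfl⟩
    exact ⟨s - a, by module⟩

theorem start_mem_ray (p v : Plane) : p ∈ ray p v := ⟨0, self_mem_Ici, by simp⟩

/-- A half-line determines its end point. -/
theorem ray_start_unique {p q v w : Plane} (hv : ‖v‖ = 1) (hw : ‖w‖ = 1)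
    (h : ray p w = ray q v) : p = q := by
  obtain ⟨s, hs, hps⟩ : p ∈ ray q v := h ▸ start_mem_ray p w
  obtain ⟨s', hs', hqs⟩ : q ∈ ray p w := h ▸ start_mem_ray q v
  simp only [mem_Ici] at hs hs' hps hqs
  rcases hs.eq_or_lt with rfl | hpos
  · simpa using hps.symm
  exfalso
  have e1 : s' • w = -(s • v) := by
    rw [← hqs] at hps
    have := sub_eq_zero.2 hps
    rw [eq_neg_iff_add_eq_zero, ← this]
    abel
  have e2 : s' = s := by
    have := congrArg norm e1
    rwa [norm_neg, norm_smul, norm_smul, hv, hw, mul_one, mul_one, Real.norm_of_nonneg hs,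
      Real.norm_of_nonneg hs'] at this
  have e3 : w = -v := by
    rw [e2, ← smul_neg] at e1
    exact smul_right_injective _ hpos.ne' e1
  obtain ⟨b, hb, hpb⟩ : p + (s + 1) • w ∈ ray q v := h ▸ ⟨s + 1, by simp; linarith, rfl⟩
  simp only [mem_Ici] at hb hpb
  have e4 : (b + 1) • v = 0 := by
    rw [← hps, e3] at hpb
    have := sub_eq_zero.2 hpb
    rw [← this]
    module
  rcases smul_eq_zero.1 e4 with h0 | h0
  · linarith
  · rw [h0, norm_zero] at hv; exact zero_ne_one hv

end Rays

/-! ### Three directions at 120 degrees. -/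

section Triods

variable {v : Fin 3 → Plane}

theorem inner_eq_of_sum_eq_zero (hv : ∀ i, ‖v i‖ = 1) (hsum : ∑ i, v i = 0) {i j : Fin 3}
    (hij : i ≠ j) : inner ℝ (v i) (v j) = -(1 / 2 : ℝ) := by
  have key : ∀ a b d : Plane, ‖a‖ = 1 → ‖b‖ = 1 → ‖d‖ = 1 → a + b + d = 0 →
      inner ℝ a b = -(1 / 2 : ℝ) := by
    intro a b d ha hb hd h
    have h1 := norm_add_sq_real a b
    rw [eq_neg_of_add_eq_zero_left h, norm_neg, ha, hb, hd] at h1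
    linarith
  rw [Fin.sum_univ_three] at hsum
  have h012 := key _ _ _ (hv 0) (hv 1) (hv 2) hsum
  have h120 := key _ _ _ (hv 1) (hv 2) (hv 0) (by rw [← hsum]; abel)
  have h201 := key _ _ _ (hv 2) (hv 0) (hv 1) (by rw [← hsum]; abel)
  fin_cases i <;> fin_cases j <;>
    first
      | exact absurd rfl hij
      | assumption
      | (rw [real_inner_comm]; assumption)

theorem angles120_of_sum_eq_zero (hv : ∀ i, ‖v i‖ = 1) (hsum : ∑ i, v i = 0) : Angles120 v := by
  refine ⟨hv, fun i j hij => ?_⟩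
  have hcos : Real.cos (2 * Real.pi / 3) = -(1 / 2) := by
    rw [show 2 * Real.pi / 3 = Real.pi - Real.pi / 3 by ring, Real.cos_pi_sub,
      Real.cos_pi_div_three]
  rw [InnerProductGeometry.angle, inner_eq_of_sum_eq_zero hv hsum hij, hv, hv, mul_one, div_one,
    ← hcos, Real.arccos_cos (by positivity) (by linarith [Real.pi_pos])]

/-- Two parallel unit vectors have inner product `±1`, not `-1/2`. -/
theorem not_parallel_of_sum_eq_zero (hv : ∀ i, ‖v i‖ = 1) (hsum : ∑ i, v i = 0) (u : Plane) :
    ¬ ∀ i, ∃ a : ℝ, v i = a • u := by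
  intro h
  obtain ⟨a, ha⟩ := h 0
  obtain ⟨b, hb⟩ := h 1
  have h0 := inner_eq_of_sum_eq_zero hv hsum (i := 0) (j := 1) (by decide)
  have h1 := real_inner_self_eq_norm_sq (v 0)
  have h2 := real_inner_self_eq_norm_sq (v 1)
  rw [hv] at h1 h2
  rw [ha, hb] at h0
  rw [ha] at h1
  rw [hb] at h2
  simp only [inner_smul_left, inner_smul_right, conj_trivial] at h0 h1 h2
  generalize (inner ℝ u u : ℝ) = m at *
  have : (1 : ℝ) = (-(1 / 2)) ^ 2 := by
    rw [← h0]; linear_combination (-1 - (b * (b * m) - 1)) * h1 - h2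
  norm_num at this

/-- Three half-lines forming angles of 120 degrees determine their common end point. -/
theorem vertex_unique {w : Fin 3 → Plane} {p c : Plane} (hv : ∀ i, ‖v i‖ = 1)
    (hvsum : ∑ i, v i = 0) (hw : ∀ i, ‖w i‖ = 1) (hwsum : ∑ i, w i = 0)
    (hsub : ∀ i, ray p (w i) ⊆ ⋃ j, ray c (v j)) : p = c := by
  obtain ⟨j, a, ha, hpa⟩ := mem_iUnion.1 (hsub 0 (start_mem_ray p (w 0)))
  simp only [mem_Ici] at ha hpa
  rcases ha.eq_or_lt with rfl | hpos
  · simpa using hpa.symm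
  -- If `p` lay on the edge `v j` at distance `a > 0` from `c`, points at distance `a / 2` from `p`
  -- would still be on that edge, so every `w i` would be parallel to `v j`.
  exfalso
  refine not_parallel_of_sum_eq_zero hw hwsum (v j) fun i => ?_
  obtain ⟨m, b, hb, hq⟩ := mem_iUnion.1
    (hsub i (show p + (a / 2) • w i ∈ ray p (w i) from ⟨a / 2, by simp; linarith, rfl⟩))
  simp only [mem_Ici] at hb hq
  have hq' : b • v m = a • v j + (a / 2) • w i := by
    rw [← hpa, add_assoc] at hq
    exact add_left_cancel hq
  -- The product with `v j` is at most `0` on another edge, but at least `a - a / 2 > 0` here.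
  have hjm : m = j := by
    by_contra hne
    have h1 := congrArg (fun z => (inner ℝ z (v j) : ℝ)) hq'
    simp only [inner_add_left, inner_smul_left, conj_trivial, inner_eq_of_sum_eq_zero hv hvsum hne,
      real_inner_self_eq_norm_sq, hv] at h1
    have h2 := neg_le_of_abs_le (abs_real_inner_le_norm (w i) (v j))
    rw [hv, hw] at h2
    nlinarith
  rw [hjm] at hq'
  refine ⟨(a / 2)⁻¹ * (b - a), ?_⟩
  rw [mul_smul, sub_smul, hq', add_sub_cancel_left, smul_smul, inv_mul_cancel₀ (by positivity),
    one_smul]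

theorem IsCompleteTriod.isCompleteHalfLine {σ : Fin 3 → ℝ → Plane} (h : IsCompleteTriod σ)
    (i : Fin 3) : IsCompleteHalfLine (σ i) :=
  ⟨h.triod.regular i, h.triod.injective i, h.length i⟩

theorem IsCompleteTriod.norm_tangent {σ : Fin 3 → ℝ → Plane} (h : IsCompleteTriod σ)
    (i : Fin 3) : ‖tangent (σ i) (Ici 0) 0‖ = 1 :=
  (h.triod.regular i).norm_tangent self_mem_Ici

theorem IsCompleteTriod.start_eq {σ : Fin 3 → ℝ → Plane} (h : IsCompleteTriod σ) {lam : ℝ}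
    (hlam : 0 < lam) {c : Plane} (heq : ∀ i, ∀ x ∈ Ici (0 : ℝ), curvature (σ i) (Ici 0) x =
      -lam * inner ℝ (σ i x - c) (normal (σ i) (Ici 0) x)) (i : Fin 3) : σ i 0 = c := by
  by_contra hne
  refine not_parallel_of_sum_eq_zero h.norm_tangent h.triod.angles (σ i 0 - c) fun j => ?_
  obtain ⟨a, ha⟩ := (h.isCompleteHalfLine j).exists_eq_add_smul_tangent hlam (heq j)
  rw [h.triod.common j i] at ha
  have ha' : σ i 0 - c = a • tangent (σ j) (Ici 0) 0 := sub_eq_of_eq_add' ha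
  have ha0 : a ≠ 0 := fun h0 => by
    rw [h0, zero_smul, sub_eq_zero] at ha'
    exact hne ha'
  exact ⟨a⁻¹, by rw [ha', smul_smul, inv_mul_cancel₀ ha0, one_smul]⟩

end Triods

/-! ### Rigidity of shrinking flows. -/

section Flows

variable {I : Set ℝ} {c : Plane}

/-- The contact argument applies to points inside the arcs; the end point follows by continuity. -/
theorem eqOn_Ici_of_Ioi {σ : ℝ → Plane} (h : IsRegularCurve σ (Ici 0)) {lam : ℝ}
    (heq : ∀ x > 0, curvature σ (Ici 0) x = -lam * inner ℝ (σ x - c) (normal σ (Ici 0) x)) :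
    ∀ x ∈ Ici (0 : ℝ),
      curvature σ (Ici 0) x = -lam * inner ℝ (σ x - c) (normal σ (Ici 0) x) := by
  have hD := uniqueDiffOn_Ici (0 : ℝ)
  refine EqOn.of_subset_closure (s := Ioi 0) (fun x hx => heq x hx) (h.continuousOn_curvature hD)
    (continuousOn_const.mul ((h.1.continuousOn.sub continuousOn_const).inner
      (h.continuousOn_normal hD))) Ioi_subset_Ici_self ?_
  rw [closure_Ioi]

/-- The scale of a homothetic shrinking enters the equation of the flow through `-r' / r`. -/
theorem ShrinksHomothetically.exists_rate {T : ℝ → Set Plane} (h : ShrinksHomothetically T I c)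
    (hI : I.OrdConnected) (hnt : I.Nontrivial) :
    ∃ r lam : ℝ → ℝ, (∀ t ∈ I, 0 < r t) ∧ StrictAntiOn r I ∧
      (∀ s ∈ I, ∀ t ∈ I, T t = AffineMap.homothety c (r t / r s) '' T s) ∧
      (∀ t ∈ I, 0 ≤ lam t) ∧ (∃ t ∈ I, 0 < lam t) ∧
      ∀ t ∈ I, ∀ (σ : ℝ → Plane) (D : Set ℝ) (x : ℝ), IsRegularCurve σ D → UniqueDiffOn ℝ D →
        Convex ℝ D → (∀ y ∈ D, σ y ∈ T t) → x ∈ D → IsCurveFlowNear T I t (σ x) →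
        curvature σ D x = -lam t * inner ℝ (σ x - c) (normal σ D x) := by
  obtain ⟨r, hr, hd, ha, hT⟩ := h
  have hnonneg : ∀ t ∈ I, 0 ≤ -(derivWithin r I t / r t) := fun t ht =>
    neg_nonneg.2 (div_nonpos_of_nonpos_of_nonneg ha.antitoneOn.derivWithin_nonpos (hr t ht).le)
  refine ⟨r, fun t => -(derivWithin r I t / r t), hr, ha, hT, hnonneg, ?_, ?_⟩
  · obtain ⟨t, ht, hne⟩ := exists_derivWithin_ne_zero hI hnt hd ha
    exact ⟨t, ht, lt_of_le_of_ne (hnonneg t ht)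
      (neg_ne_zero.2 (div_ne_zero hne (hr t ht).ne')).symm⟩
  · intro t ht σ D x hσ hD hconv hsub hx hflow
    rw [neg_neg]
    exact hflow.curvature_eq (uniqueDiffOn_of_ordConnected hI hnt) ht (hr t ht)
      (hd t ht).hasDerivWithinAt (fun s hs => hT s hs t ht) hσ hD hconv hsub hx rfl

theorem triodFlow_rigidity (hI : I.OrdConnected) (hnt : I.Nontrivial)
    (σ : ℝ → Fin 3 → ℝ → Plane) (h : IsTriodFlow σ I)
    (hs : ShrinksHomothetically (fun t => triodSet (σ t)) I c) :
    (∃ v : Fin 3 → Plane, Angles120 v ∧ ∀ t ∈ I, triodSet (σ t) = ⋃ i, ray c (v i)) ∧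
      (∀ t ∈ I, ∀ i, σ t i 0 = c) ∧
      ∀ t ∈ I, ∀ i, ∀ x ∈ Ici (0 : ℝ), curvature (σ t i) (Ici 0) x = 0 := by
  obtain ⟨r, lam, hr, -, hT, hlam, ⟨t₁, ht₁, hpos⟩, heq⟩ := hs.exists_rate hI hnt
  have hsh : ∀ t ∈ I, ∀ i, ∀ x ∈ Ici (0 : ℝ), curvature (σ t i) (Ici 0) x =
      -lam t * inner ℝ (σ t i x - c) (normal (σ t i) (Ici 0) x) := fun t ht i =>
    eqOn_Ici_of_Ioi ((h.slice t ht).triod.regular i) fun x hx =>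
      heq t ht (σ t i) (Ici 0) x ((h.slice t ht).triod.regular i) (uniqueDiffOn_Ici 0)
        (convex_Ici 0) (fun y hy => mem_iUnion.2 ⟨i, mem_image_of_mem _ hy⟩) (le_of_lt hx)
        (h.edges t ht i x hx)
  have hk : ∀ t ∈ I, ∀ i, ∀ x ∈ Ici (0 : ℝ), curvature (σ t i) (Ici 0) x = 0 := fun t ht i =>
    ((h.slice t ht).isCompleteHalfLine i).curvature_eq_zero (hlam t ht) (hsh t ht i)
  have himg : ∀ t ∈ I, ∀ i, σ t i '' Ici 0 = ray (σ t i 0) (tangent (σ t i) (Ici 0) 0) :=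
    fun t ht i => ((h.slice t ht).isCompleteHalfLine i).image_eq_ray (hk t ht i)
  have h1 := h.slice t₁ ht₁
  have hset : ∀ t ∈ I, triodSet (σ t) = ⋃ i, ray c (tangent (σ t₁ i) (Ici 0) 0) := by
    intro t ht
    rw [hT t₁ ht₁ t ht, triodSet, image_iUnion]
    refine iUnion_congr fun i => ?_
    rw [himg t₁ ht₁ i, h1.start_eq hpos (hsh t₁ ht₁) i,
      homothety_image_ray_self (div_pos (hr t ht) (hr t₁ ht₁))]
  refine ⟨⟨_, angles120_of_sum_eq_zero h1.norm_tangent h1.triod.angles, hset⟩, ?_, hk⟩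
  intro t ht i
  have h2 := h.slice t ht
  -- `lam t` may be `0` at this time, so the 3-point is recovered from the set alone.
  refine vertex_unique h1.norm_tangent h1.triod.angles h2.norm_tangent h2.triod.angles fun j => ?_
  rw [← hset t ht, h2.triod.common i j, ← himg t ht j]
  exact subset_iUnion (fun j => σ t j '' Ici 0) j

theorem lineFlow_rigidity (hI : I.OrdConnected) (hnt : I.Nontrivial) (σ : ℝ → ℝ → Plane)
    (h : IsLineFlow σ I) (hs : ShrinksHomothetically (fun t => range (σ t)) I c) :
    (∃ v : Plane, ‖v‖ = 1 ∧ ∀ t ∈ I, range (σ t) = straightLine c v) ∧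
      ∀ t ∈ I, ∀ x, curvature (σ t) univ x = 0 := by
  obtain ⟨r, lam, hr, -, hT, hlam, ⟨t₁, ht₁, hpos⟩, heq⟩ := hs.exists_rate hI hnt
  have hsh : ∀ t ∈ I, ∀ x, curvature (σ t) univ x =
      -lam t * inner ℝ (σ t x - c) (normal (σ t) univ x) := fun t ht x =>
    heq t ht (σ t) univ x (h.slice t ht).regular uniqueDiffOn_univ convex_univ
      (fun y _ => mem_range_self y) (mem_univ x) (h.points t ht x)
  have hk : ∀ t ∈ I, ∀ x, curvature (σ t) univ x = 0 := fun t ht =>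
    (h.slice t ht).curvature_eq_zero (hlam t ht) (hsh t ht)
  have h1 := h.slice t₁ ht₁
  refine ⟨⟨tangent (σ t₁) univ 0, h1.regular.norm_tangent (mem_univ _), fun t ht => ?_⟩, hk⟩
  obtain ⟨a, ha⟩ := h1.exists_eq_add_smul_tangent hpos (hsh t₁ ht₁)
  rw [hT t₁ ht₁ t ht, h1.range_eq_straightLine (hk t₁ ht₁), ha, straightLine_add_smul,
    homothety_image_straightLine (div_pos (hr t ht) (hr t₁ ht₁))]

theorem halfLineFlow_rigidity (hI : I.OrdConnected) (hnt : I.Nontrivial) (σ : ℝ → ℝ → Plane)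
    (h : IsHalfLineFlow σ I) (hs : ShrinksHomothetically (fun t => σ t '' Ici 0) I c) :
    (∃ (v : Plane) (a : ℝ → ℝ), ‖v‖ = 1 ∧
      ∀ t ∈ I, σ t 0 = c + a t • v ∧ σ t '' Ici 0 = ray (σ t 0) v) ∧
    (∀ t ∈ I, ∀ x ∈ Ici (0 : ℝ), curvature (σ t) (Ici 0) x = 0) ∧
    ((∀ s ∈ I, ∀ t ∈ I, σ s 0 = σ t 0) →
      ∃ v : Plane, ‖v‖ = 1 ∧ ∀ t ∈ I, σ t '' Ici 0 = ray c v) := by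
  obtain ⟨r, lam, hr, hanti, hT, hlam, ⟨t₁, ht₁, hpos⟩, heq⟩ := hs.exists_rate hI hnt
  have hsh : ∀ t ∈ I, ∀ x ∈ Ici (0 : ℝ), curvature (σ t) (Ici 0) x =
      -lam t * inner ℝ (σ t x - c) (normal (σ t) (Ici 0) x) := fun t ht =>
    eqOn_Ici_of_Ioi (h.slice t ht).regular fun x hx =>
      heq t ht (σ t) (Ici 0) x (h.slice t ht).regular (uniqueDiffOn_Ici 0)
        (convex_Ici 0) (fun y hy => mem_image_of_mem _ hy) (le_of_lt hx) (h.points t ht x hx)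
  have hk : ∀ t ∈ I, ∀ x ∈ Ici (0 : ℝ), curvature (σ t) (Ici 0) x = 0 := fun t ht =>
    (h.slice t ht).curvature_eq_zero (hlam t ht) (hsh t ht)
  have h1 := h.slice t₁ ht₁
  have hv : ‖tangent (σ t₁) (Ici 0) 0‖ = 1 := h1.regular.norm_tangent self_mem_Ici
  obtain ⟨a, ha⟩ := h1.exists_eq_add_smul_tangent hpos (hsh t₁ ht₁)
  have himg₁ := h1.image_eq_ray (hk t₁ ht₁)
  set v := tangent (σ t₁) (Ici 0) 0 with hvdef
  have himg : ∀ t ∈ I, σ t '' Ici 0 = ray (c + (r t / r t₁ * a) • v) v := fun t ht => by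
    rw [hT t₁ ht₁ t ht, himg₁, ha, homothety_image_ray (div_pos (hr t ht) (hr t₁ ht₁))]
  have hstart : ∀ t ∈ I, σ t 0 = c + (r t / r t₁ * a) • v := fun t ht =>
    ray_start_unique hv ((h.slice t ht).regular.norm_tangent self_mem_Ici)
      (((h.slice t ht).image_eq_ray (hk t ht)).symm.trans (himg t ht))
  refine ⟨⟨v, fun t => r t / r t₁ * a, hv, fun t ht => ⟨hstart t ht, ?_⟩⟩, hk, fun hfix => ?_⟩
  · rw [hstart t ht, himg t ht]
  · have hv0 : v ≠ 0 := fun h0 => by rw [h0, norm_zero] at hv; exact zero_ne_one hv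
    obtain ⟨s, hsI, t, htI, hst⟩ := hnt.exists_lt
    -- The end point sits at the signed distance `r t / r t₁ * a` from `c`, which varies with the
    -- strictly decreasing `r` unless `a = 0`.
    have ha0 : a = 0 := by
      have e := hfix s hsI t htI
      rw [hstart s hsI, hstart t htI] at e
      have e1 := smul_left_injective ℝ hv0 (add_left_cancel e)
      by_contra hne
      have e2 := mul_right_cancel₀ hne e1
      rw [div_left_inj' (hr t₁ ht₁).ne'] at e2
      exact (hanti hsI htI hst).ne' e2
    refine ⟨v, hv, fun t ht => ?_⟩
    rw [himg t ht, ha0, mul_zero, zero_smul, add_zero]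

end Flows

/-! ### The main theorem. -/

theorem IsShrinker.eq_neg_one_mul {σ : ℝ → Plane} {D : Set ℝ} (h : IsShrinker σ D) :
    ∀ x ∈ D, curvature σ D x = -1 * inner ℝ (σ x - 0) (normal σ D x) := fun x hx => by
  rw [h x hx, sub_zero, neg_one_mul]

theorem mainTheorem8 :
    -- complete embedded triods without end points with `k = -⟨x | ν⟩`
    (∀ σ : Fin 3 → ℝ → Plane, IsCompleteTriod σ → (∀ i, IsShrinker (σ i) (Ici 0)) →
      (∀ i, σ i 0 = 0) ∧
      (∃ v : Fin 3 → Plane, Angles120 v ∧ ∀ i, σ i '' Ici 0 = ray 0 (v i)) ∧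
      ∀ i, ∀ x ∈ Ici (0 : ℝ), curvature (σ i) (Ici 0) x = 0) ∧
    -- complete embedded curves without end points with `k = -⟨x | ν⟩`
    (∀ σ : ℝ → Plane, IsCompleteLine σ → IsShrinker σ univ →
      (∃ v : Plane, ‖v‖ = 1 ∧ range σ = straightLine 0 v) ∧
      ∀ x, curvature σ univ x = 0) ∧
    -- complete embedded curves with one end point with `k = -⟨x | ν⟩`
    (∀ σ : ℝ → Plane, IsCompleteHalfLine σ → IsShrinker σ (Ici 0) →
      (∃ (v : Plane) (a : ℝ), ‖v‖ = 1 ∧ σ 0 = a • v ∧ σ '' Ici 0 = ray (σ 0) v) ∧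
      ∀ x ∈ Ici (0 : ℝ), curvature σ (Ici 0) x = 0) ∧
    -- homothetically shrinking flows
    (∀ (I : Set ℝ) (c : Plane), I.OrdConnected → I.Nontrivial →
      (∀ σ : ℝ → Fin 3 → ℝ → Plane, IsTriodFlow σ I →
        ShrinksHomothetically (fun t => triodSet (σ t)) I c →
        (∃ v : Fin 3 → Plane, Angles120 v ∧
          ∀ t ∈ I, triodSet (σ t) = ⋃ i, ray c (v i)) ∧
        (∀ t ∈ I, ∀ i, σ t i 0 = c) ∧
        ∀ t ∈ I, ∀ i, ∀ x ∈ Ici (0 : ℝ), curvature (σ t i) (Ici 0) x = 0) ∧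
      (∀ σ : ℝ → ℝ → Plane, IsLineFlow σ I →
        ShrinksHomothetically (fun t => range (σ t)) I c →
        (∃ v : Plane, ‖v‖ = 1 ∧ ∀ t ∈ I, range (σ t) = straightLine c v) ∧
        ∀ t ∈ I, ∀ x, curvature (σ t) univ x = 0) ∧
      (∀ σ : ℝ → ℝ → Plane, IsHalfLineFlow σ I →
        ShrinksHomothetically (fun t => σ t '' Ici 0) I c →
        (∃ (v : Plane) (a : ℝ → ℝ), ‖v‖ = 1 ∧
          ∀ t ∈ I, σ t 0 = c + a t • v ∧ σ t '' Ici 0 = ray (σ t 0) v) ∧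
        (∀ t ∈ I, ∀ x ∈ Ici (0 : ℝ), curvature (σ t) (Ici 0) x = 0) ∧
        -- if moreover the end point is kept fixed, the half-line starts at `c` and is static
        ((∀ s ∈ I, ∀ t ∈ I, σ s 0 = σ t 0) →
          ∃ v : Plane, ‖v‖ = 1 ∧ ∀ t ∈ I, σ t '' Ici 0 = ray c v))) := by
  refine ⟨fun σ h hs => ?_, fun σ h hs => ?_, fun σ h hs => ?_, fun I c hI hnt =>
    ⟨triodFlow_rigidity hI hnt, lineFlow_rigidity hI hnt, halfLineFlow_rigidity hI hnt⟩⟩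
  · have hk : ∀ i, ∀ x ∈ Ici (0 : ℝ), curvature (σ i) (Ici 0) x = 0 := fun i =>
      (h.isCompleteHalfLine i).curvature_eq_zero zero_le_one (hs i).eq_neg_one_mul
    have h0 : ∀ i, σ i 0 = 0 := h.start_eq one_pos fun i => (hs i).eq_neg_one_mul
    refine ⟨h0, ⟨_, angles120_of_sum_eq_zero h.norm_tangent h.triod.angles, fun i => ?_⟩, hk⟩
    rw [(h.isCompleteHalfLine i).image_eq_ray (hk i), h0 i]
  · have hk := h.curvature_eq_zero zero_le_one fun x => hs.eq_neg_one_mul x (mem_univ x)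
    refine ⟨⟨_, h.regular.norm_tangent (mem_univ 0), ?_⟩, hk⟩
    obtain ⟨a, ha⟩ := h.exists_eq_add_smul_tangent one_pos
      fun x => hs.eq_neg_one_mul x (mem_univ x)
    rw [h.range_eq_straightLine hk, ha, straightLine_add_smul]
  · have hk := h.curvature_eq_zero zero_le_one hs.eq_neg_one_mul
    obtain ⟨a, ha⟩ := h.exists_eq_add_smul_tangent one_pos hs.eq_neg_one_mul
    rw [zero_add] at ha
    exact ⟨⟨_, a, h.regular.norm_tangent self_mem_Ici, ha, h.image_eq_ray hk⟩, hk⟩
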